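/- Let $n\ge 0$ and let $w\in S_n$ be a permutation. The box-ball system of $w$ starts at time $0$ with the balls $w_1,w_2,\dots,w_n$ in $n$ consecutive boxes (the boxes being labeled by the natural numbers, with infinitely many empty boxes to the right); the state at time $t+1$ is obtained from the state at time $t$ by moving each ball once, beginning with the smallest, to the nearest empty box to its right. An increasing run of a state is a maximal string of balls with increasing labels in consecutive boxes. A state is a steady state if its sequence of increasing runs (read from left to right) is preserved by all subsequent moves; its runs are then called solitons. The soliton decomposition $\mathrm{SD}(w)$ is the array whose rows, from top to bottom, are the solitons of a steady state of the box-ball system of $w$, read from right to left; it does not depend on the steady state chosen. Let $\mathrm{P}(w)$ be the Robinson--Schensted insertion tableau of $w$, obtained by row-inserting $w_1,w_2,\dots,w_n$ successively into the empty tableau. The shape $\mathrm{sh}$ of an array is its sequence of row lengths, top row first. Then the box-ball system of $w$ reaches a steady state; the soliton partition $\Lambda=\mathrm{sh}\,\mathrm{SD}(w)$ and the RS partition $\lambda=\mathrm{sh}\,\mathrm{P}(w)$ are partitions of $n$ (weakly decreasing sequences of positive integers with sum $n$); and $\Lambda$ is smaller than or equal to $\lambda$ in the dominance order, that is, $$\Lambda_1+\Lambda_2+\dots+\Lambda_k\;\le\;\lambda_1+\lambda_2+\dots+\lambda_k\qquad\text{for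 all } k\ge 1,$$ where missing parts are counted as $0$. -/

import Mathlib

namespace BoxBall

/-! ### The box-ball system

A state of the box-ball system with `n` balls (labelled by `Fin n`, i.e. `0, …, n-1` in place of
`1, …, n`) is recorded by the map sending each ball to the box (a natural number) containing it.
All states reached from a permutation are injective maps, see `bbsState_injective`. -/

/-- To the right of every box there is an empty box. -/
theorem exists_empty_box {n : ℕ} (c : Fin n → ℕ) (b : ℕ) : ∃ p, b < p ∧ ∀ j, c j ≠ p := by
  obtain ⟨p, hp⟩ := Set.Infinite.exists_notMem_finite (Set.Ioi_infinite b) (Set.finite_range c)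
  exact ⟨p, hp.1, fun j hj => hp.2 ⟨j, hj⟩⟩

/-- The nearest empty box strictly to the right of box `b` in the state `c`. -/
def nextEmpty {n : ℕ} (c : Fin n → ℕ) (b : ℕ) : ℕ :=
  Nat.find (exists_empty_box c b)

/-- Move ball `i` from its box to the nearest empty box to its right. -/
def moveBall {n : ℕ} (c : Fin n → ℕ) (i : Fin n) : Fin n → ℕ :=
  Function.update c i (nextEmpty c (c i))

/-- One BBS move: every ball is moved once to the nearest empty box to its right,
beginning with the smallest ball. -/
def bbsMove {n : ℕ} (c : Fin n → ℕ) : Fin n → ℕ :=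
  (List.finRange n).foldl moveBall c

/-- The initial state of a permutation `w`: its one-line notation `w 0, w 1, …, w (n-1)` is put
into the consecutive boxes `0, 1, …, n-1`; thus ball `i` lies in box `w⁻¹ i`. -/
def initialState {n : ℕ} (w : Equiv.Perm (Fin n)) : Fin n → ℕ :=
  fun i => (w.symm i : ℕ)

/-- The state at time `t` of the box-ball system containing `w`. -/
def bbsState {n : ℕ} (w : Equiv.Perm (Fin n)) (t : ℕ) : Fin n → ℕ :=
  bbsMove^[t] (initialState w)

/-- The balls of a state, read from left to right. -/
def ballWord {n : ℕ} (c : Fin n → ℕ) : List (Fin n) :=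
  (List.finRange n).mergeSort (fun i j => decide (c i ≤ c j))

/-- The increasing runs of a state, listed from left to right: the maximal strings of balls
that lie in consecutive boxes (no empty box in between) and whose labels increase. -/
def runs {n : ℕ} (c : Fin n → ℕ) : List (List (Fin n)) :=
  (ballWord c).splitBy (fun i j => decide (c j = c i + 1 ∧ i < j))

/-- A state is a steady state if all its increasing runs are preserved by all subsequent BBS
moves; these runs are then the solitons. -/
def IsSteadyState {n : ℕ} (c : Fin n → ℕ) : Prop :=
  ∀ t : ℕ, runs (bbsMove^[t] c) = runs c

/-- The first time at which the box-ball system containing `w` is in a steady state. -/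
noncomputable def steadyTime {n : ℕ} (w : Equiv.Perm (Fin n)) : ℕ :=
  sInf {t : ℕ | IsSteadyState (bbsState w t)}

/-- The soliton decomposition `SD(w)`, as the list of its rows from top to bottom: the rightmost
soliton of a steady state is the first row, the soliton to its left is the second row, and so on. -/
noncomputable def solitonDecomposition {n : ℕ} (w : Equiv.Perm (Fin n)) : List (List (Fin n)) :=
  (runs (bbsState w (steadyTime w))).reverse

/-! ### Robinson–Schensted insertion -/

/-- Insert `x` into a row: `x` replaces (bumps) the leftmost entry larger than `x`, or is appended
at the end if there is none. Returns the new row and the bumped entry, if any. -/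
def rowInsert {α : Type*} [LinearOrder α] (x : α) : List α → List α × Option α
  | [] => ([x], none)
  | y :: ys =>
    if x < y then (x :: ys, some y) else (y :: (rowInsert x ys).1, (rowInsert x ys).2)

/-- Insert `x` into a tableau (a list of rows, top row first): the entry bumped from a row is
inserted into the next row. -/
def tableauInsert {α : Type*} [LinearOrder α] (x : α) : List (List α) → List (List α)
  | [] => [[x]]
  | r :: rs =>
    match rowInsert x r with
    | (r', none) => r' :: rs
    | (r', some y) => r' :: tableauInsert y rs

/-- The RS insertion tableau `P(w)`: insert `w 0, w 1, …, w (n-1)` successively into the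
empty tableau. -/
def insertionTableau {n : ℕ} (w : Equiv.Perm (Fin n)) : List (List (Fin n)) :=
  (List.ofFn w).foldl (fun T x => tableauInsert x T) []

/-! ### Shapes, partitions, dominance -/

/-- The shape of a tableau: the list of its row lengths, top row first. -/
def shape {α : Type*} (T : List (List α)) : List ℕ :=
  T.map List.length

/-- `l` is an integer partition of `n`: a weakly decreasing list of positive integers
with sum `n`. -/
structure IsPartitionOf (n : ℕ) (l : List ℕ) : Prop where
  weaklyDecreasing : l.Pairwise (· ≥ ·)
  pos : ∀ p ∈ l, 0 < p
  sum_eq : l.sum = n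

/-- `l` is smaller than or equal to `m` in the dominance order on partitions:
`l₁ + ⋯ + l_k ≤ m₁ + ⋯ + m_k` for all `k` (missing parts count as `0`). -/
def DominanceLE (l m : List ℕ) : Prop :=
  ∀ k : ℕ, (l.take k).sum ≤ (m.take k).sum

/-! ### Well-definedness -/

theorem moveBall_injective {n : ℕ} {c : Fin n → ℕ} (hc : Function.Injective c) (i : Fin n) :
    Function.Injective (moveBall c i) := by
  have h : ∀ j, c j ≠ nextEmpty c (c i) := (Nat.find_spec (exists_empty_box c (c i))).2
  intro a b hab
  by_cases ha : a = i <;> by_cases hb : b = i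
  · rw [ha, hb]
  · subst ha
    simp only [moveBall, Function.update_self, Function.update_of_ne hb] at hab
    exact absurd hab.symm (h b)
  · subst hb
    simp only [moveBall, Function.update_self, Function.update_of_ne ha] at hab
    exact absurd hab (h a)
  · simp only [moveBall, Function.update_of_ne ha, Function.update_of_ne hb] at hab
    exact hc hab

theorem bbsMove_injective {n : ℕ} {c : Fin n → ℕ} (hc : Function.Injective c) :
    Function.Injective (bbsMove c) := by
  unfold bbsMove
  induction List.finRange n generalizing c with
  | nil => exact hc
  | cons i l ih => exact ih (moveBall_injective hc i)

/-- Every state of the box-ball system containing `w` has at most one ball in each box. -/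
theorem bbsState_injective {n : ℕ} (w : Equiv.Perm (Fin n)) (t : ℕ) :
    Function.Injective (bbsState w t) := by
  unfold bbsState
  induction t with
  | zero => exact fun a b h => w.symm.injective (Fin.ext h)
  | succ t ih =>
    rw [Function.iterate_succ_apply']
    exact bbsMove_injective ih

/-- The soliton decomposition can be read off from any steady state. -/
theorem solitonDecomposition_eq {n : ℕ} (w : Equiv.Perm (Fin n)) (t : ℕ)
    (ht : IsSteadyState (bbsState w t)) :
    solitonDecomposition w = (runs (bbsState w t)).reverse := by
  have h0 : IsSteadyState (bbsState w (steadyTime w)) :=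
    Nat.sInf_mem (s := {t : ℕ | IsSteadyState (bbsState w t)}) ⟨t, ht⟩
  have hle : steadyTime w ≤ t := Nat.sInf_le (s := {t : ℕ | IsSteadyState (bbsState w t)}) ht
  have h1 := h0 (t - steadyTime w)
  unfold solitonDecomposition
  rw [← h1, bbsState, ← Function.iterate_add_apply, Nat.sub_add_cancel hle, ← bbsState]

end BoxBall

namespace BoxBall

/-! ### Knuth equivalence -/

/-! The link between the two partitions is Knuth equivalence. Sweep a move from left to right,
keeping the increasing list of balls that cross into the boxes from `p` on (`carrier`). At a box
holding a ball, that ball is row-inserted into the carrier and the bumped ball, if any, stays in the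
box; at an empty box the smallest carried ball is dropped. Row insertion is a Knuth equivalence
(`knuth_bump`), so the ball word never leaves the Knuth class of `w` (`knuth_bbsState`).

The largest size of a union of `k` increasing subsequences is a Knuth invariant
(`Knuth.coloringLE`), and for the reading word of a tableau it is at most the total length of the
first `k` rows (`IsTableau.countP_le`). In a steady state the `k` rightmost solitons form such a
union, which gives the dominance inequality.

A steady state exists because the runs are the fibres of the run index (`runs_eq_fiberLists`), and
the run index of each ball is bounded and weakly increasing in time
(`runIndex_le_runIndex_bbsMove`). Once the indices are constant, each run advances by its own length
per move, so a longer run to the left of a shorter one would eventually overtake it; hence the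
lengths weakly increase from left to right. -/

/-- Knuth equivalence of words. -/
inductive Knuth {α : Type*} [LinearOrder α] : List α → List α → Prop
  | refl (u : List α) : Knuth u u
  | symm {u v : List α} : Knuth u v → Knuth v u
  | trans {u v w : List α} : Knuth u v → Knuth v w → Knuth u w
  | left (p s : List α) {x y z : α} : x < y → y < z →
      Knuth (p ++ x :: z :: y :: s) (p ++ z :: x :: y :: s)
  | right (p s : List α) {x y z : α} : x < y → y < z →
      Knuth (p ++ y :: x :: z :: s) (p ++ y :: z :: x :: s)

section Words

variable {α : Type*} [LinearOrder α]

theorem Knuth.append {u v : List α} (h : Knuth u v) (a b : List α) :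
    Knuth (a ++ u ++ b) (a ++ v ++ b) := by
  induction h with
  | refl u => exact .refl _
  | symm _ ih => exact ih.symm
  | trans _ _ ih1 ih2 => exact ih1.trans ih2
  | left p s hxy hyz => simpa using Knuth.left (a ++ p) (s ++ b) hxy hyz
  | right p s hxy hyz => simpa using Knuth.right (a ++ p) (s ++ b) hxy hyz

theorem Knuth.append_left {u v : List α} (h : Knuth u v) (a : List α) :
    Knuth (a ++ u) (a ++ v) := by
  simpa using h.append a []

theorem Knuth.append_right {u v : List α} (h : Knuth u v) (b : List α) :
    Knuth (u ++ b) (v ++ b) := by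
  simpa using h.append [] b

theorem Knuth.cons {u v : List α} (h : Knuth u v) (a : α) : Knuth (a :: u) (a :: v) :=
  h.append_left [a]

theorem Knuth.perm {u v : List α} (h : Knuth u v) : u.Perm v := by
  induction h with
  | refl u => exact .refl _
  | symm _ ih => exact ih.symm
  | trans _ _ ih1 ih2 => exact ih1.trans ih2
  | left p s _ _ => exact (List.Perm.swap _ _ _).append_left p
  | right p s _ _ => exact ((List.Perm.swap _ _ _).cons _).append_left p

theorem knuth_cons_append_singleton (x y : α) (l : List α) (hxy : x < y)
    (hl : (y :: l).Pairwise (· < ·)) : Knuth (y :: l ++ [x]) (y :: x :: l) := by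
  induction l generalizing y with
  | nil => exact .refl _
  | cons a l ih =>
    have hya : y < a := List.rel_of_pairwise_cons hl (by simp)
    have h1 := (ih a (hxy.trans hya) hl.of_cons).cons y
    exact h1.trans (Knuth.right [] l hxy hya).symm

theorem knuth_append_cons_cons (x y : α) (l s : List α) (hxy : x < y)
    (hl : (l ++ [x]).Pairwise (· < ·)) : Knuth (l ++ y :: x :: s) (y :: (l ++ x :: s)) := by
  induction l with
  | nil => exact .refl _
  | cons a l ih =>
    have h1 := (ih hl.of_cons).cons a
    refine h1.trans ?_
    have hax : ∀ b ∈ l ++ [x], a < b := fun b hb => List.rel_of_pairwise_cons hl hb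
    cases l with
    | nil => exact Knuth.left [] s (hax x (by simp)) hxy
    | cons b l =>
      have hbx : b < x := List.rel_of_pairwise_cons hl.of_cons (by simp)
      exact Knuth.left [] (l ++ x :: s) (hax b (by simp)) (hbx.trans hxy)

/-- Row insertion with bumping, as a Knuth equivalence. -/
theorem knuth_bump (x y : α) (l s : List α) (hl : (l ++ [x]).Pairwise (· < ·)) (hxy : x < y)
    (hs : (y :: s).Pairwise (· < ·)) : Knuth (l ++ y :: s ++ [x]) (y :: (l ++ x :: s)) := by
  have h1 := (knuth_cons_append_singleton x y s hxy hs).append_left l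
  rw [← List.append_assoc] at h1
  exact h1.trans (knuth_append_cons_cons x y l s hxy hl)

/-! ### Unions of `k` increasing subsequences -/

/-- The colours below `k` of the colouring `f` select increasing subsequences of the word `u`. -/
def IsIncreasingColoring (k : ℕ) (f : α → ℕ) (u : List α) : Prop :=
  u.Pairwise fun a b => f a = f b → f a < k → a < b

/-- Every union of `k` increasing subsequences of `u` is at most as large as some such union
for `v`. -/
def ColoringLE (k : ℕ) (u v : List α) : Prop :=
  ∀ f, IsIncreasingColoring k f u → ∃ g, IsIncreasingColoring k g v ∧
    u.countP (fun a => decide (f a < k)) ≤ v.countP (fun a => decide (g a < k))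

theorem ColoringLE.trans {k : ℕ} {u v w : List α} (h1 : ColoringLE k u v)
    (h2 : ColoringLE k v w) : ColoringLE k u w := by
  intro f hf
  obtain ⟨g, hg, hfg⟩ := h1 f hf
  obtain ⟨h, hh, hgh⟩ := h2 g hg
  exact ⟨h, hh, hfg.trans hgh⟩

theorem coloringLE_of_coloring {k : ℕ} {u v : List α} (huv : u.Perm v)
    (h : ∀ f, IsIncreasingColoring k f u → IsIncreasingColoring k f v) : ColoringLE k u v :=
  fun f hf => ⟨f, h f hf, (huv.countP_eq _).le⟩

/-! ### Recolouring across the elementary Knuth relations. -/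

theorem swap_lt_iff {k c d : ℕ} (hc : c < k) (hd : d < k) (e : ℕ) :
    Equiv.swap c d e < k ↔ e < k := by
  rcases eq_or_ne e c with rfl | h1
  · simp [hc, hd]
  rcases eq_or_ne e d with rfl | h2
  · simp [hc, hd]
  rw [Equiv.swap_apply_of_ne_of_ne h1 h2]

theorem isIncreasingColoring_append_cons_cons_cons {k : ℕ} {f : α → ℕ} {p s : List α}
    {a b c : α} : IsIncreasingColoring k f (p ++ a :: b :: c :: s) ↔
      IsIncreasingColoring k f p ∧ IsIncreasingColoring k f s ∧
      (∀ d ∈ p, ∀ e ∈ s, f d = f e → f d < k → d < e) ∧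
      (∀ d ∈ p, (f d = f a → f d < k → d < a) ∧ (f d = f b → f d < k → d < b) ∧
        (f d = f c → f d < k → d < c)) ∧
      (∀ e ∈ s, (f a = f e → f a < k → a < e) ∧ (f b = f e → f b < k → b < e) ∧
        (f c = f e → f c < k → c < e)) ∧
      (f a = f b → f a < k → a < b) ∧ (f a = f c → f a < k → a < c) ∧
      (f b = f c → f b < k → b < c) := by
  simp only [IsIncreasingColoring, List.pairwise_append, List.pairwise_cons, List.mem_cons,
    forall_eq_or_imp]
  constructor
  · rintro ⟨h1, ⟨⟨h2, h3, h4⟩, ⟨h5, h6⟩, h7, h8⟩, h9⟩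
    exact ⟨h1, h8, fun d hd => (h9 d hd).2.2.2,
      fun d hd => ⟨(h9 d hd).1, (h9 d hd).2.1, (h9 d hd).2.2.1⟩,
      fun e he => ⟨h4 e he, h6 e he, h7 e he⟩, h2, h3, h5⟩
  · rintro ⟨h1, h8, h, h', h'', h2, h3, h5⟩
    exact ⟨h1, ⟨⟨h2, h3, fun e he => (h'' e he).1⟩, ⟨h5, fun e he => (h'' e he).2.1⟩,
      fun e he => (h'' e he).2.2, h8⟩,
      fun d hd => ⟨(h' d hd).1, (h' d hd).2.1, (h' d hd).2.2, h d hd⟩⟩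

theorem IsIncreasingColoring.congr {k : ℕ} {f g : α → ℕ} {u : List α}
    (h : IsIncreasingColoring k f u) (hfg : ∀ a ∈ u, g a = f a) :
    IsIncreasingColoring k g u := by
  refine List.Pairwise.imp_of_mem ?_ h
  intro a b ha hb hab
  rwa [hfg a ha, hfg b hb]

theorem IsIncreasingColoring.swap {k c d : ℕ} {f g : α → ℕ} {u : List α} (hc : c < k)
    (hd : d < k) (h : IsIncreasingColoring k f u) (hfg : ∀ a ∈ u, g a = Equiv.swap c d (f a)) :
    IsIncreasingColoring k g u := by
  refine List.Pairwise.imp_of_mem ?_ h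
  intro a b ha hb hab
  rw [hfg a ha, hfg b hb, swap_lt_iff hc hd]
  exact fun h1 => hab ((Equiv.swap c d).injective h1)

/-- Only a common colour of `x` and `z` obstructs the swap, and then `y`, smaller than the preceding
`z`, has another colour. If `y` is selected, exchange the tails of the two subsequences: `x`
continues with `y` and what followed it, `z` with what followed `z`. If not, `y` replaces `z` in the
subsequence of `x`, which is legitimate as `x < y < z`. -/
theorem coloringLE_left {k : ℕ} (p s : List α) {x y z : α} (hxy : x < y) (hyz : y < z)
    (hnd : (p ++ x :: z :: y :: s).Nodup) :
    ColoringLE k (p ++ x :: z :: y :: s) (p ++ z :: x :: y :: s) := by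
  intro f hf
  have hperm : (p ++ x :: z :: y :: s).Perm (p ++ z :: x :: y :: s) :=
    (List.Perm.swap _ _ _).append_left p
  simp only [List.nodup_append, List.nodup_cons, List.mem_cons, not_or] at hnd
  obtain ⟨-, ⟨⟨-, -, hxs⟩, ⟨-, hzs⟩, hys, -⟩, hps⟩ := hnd
  have hf' := isIncreasingColoring_append_cons_cons_cons.1 hf
  obtain ⟨h1, h2, h3, h4, h5, h6, h7, h8⟩ := hf'
  have hxz := hxy.trans hyz
  by_cases hc : f x = f z ∧ f x < k
  swap
  · refine ⟨f, isIncreasingColoring_append_cons_cons_cons.2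
      ⟨h1, h2, h3, fun d hd => ?_, fun e he => ?_, ?_, ?_, ?_⟩, (hperm.countP_eq _).le⟩
    all_goals grind
  obtain ⟨hfxz, hfx⟩ := hc
  have hyx : f y ≠ f x := fun h => absurd (h8 (by rw [h, hfxz]) (hfxz ▸ hfx)) hyz.not_gt
  by_cases hy : f y < k
  · set g : α → ℕ := fun a => if a = z ∨ a = y ∨ a ∈ s then Equiv.swap (f x) (f y) (f a) else f a
      with hg
    have gz : g z = f y := by simp [hg, ← hfxz]
    have gy : g y = f x := by simp [hg]
    have gx : g x = f x := by simp [hg, hxz.ne, hxy.ne, hxs]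
    have gp : ∀ a ∈ p, g a = f a := by
      intro a ha
      have := hps a ha
      simp only [hg]
      rw [if_neg]
      grind
    have gs : ∀ a ∈ s, g a = Equiv.swap (f x) (f y) (f a) := by
      intro a ha
      simp [hg, ha]
    refine ⟨g, isIncreasingColoring_append_cons_cons_cons.2
      ⟨h1.congr gp, h2.swap hfx hy gs, fun d hd e he => ?_, fun d hd => ?_, fun e he => ?_,
        ?_, ?_, ?_⟩, ?_⟩
    · have := h4 d hd
      have := h5 e he
      have := h3 d hd e he
      rw [gp d hd, gs e he, Equiv.swap_apply_def]
      clear_value g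
      clear hg gs gp hps
      grind
    · have := h4 d hd
      rw [gp d hd, gz, gx, gy]
      grind
    · have := h5 e he
      rw [gs e he, gz, gx, gy, Equiv.swap_apply_def]
      clear_value g
      clear hg gs gp hps
      grind
    · rw [gz, gx]; exact fun h => absurd h hyx
    · rw [gz, gy]; exact fun h => absurd h hyx
    · exact fun _ _ => hxy
    · rw [hperm.countP_eq]
      refine (List.countP_congr fun a ha => ?_).le
      simp only [hg, decide_eq_true_eq]
      split_ifs
      · rw [swap_lt_iff hfx hy]
      · rfl
  · set g : α → ℕ := fun a => if a = z then f y else if a = y then f x else f a with hg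
    have gz : g z = f y := by simp [hg]
    have gy : g y = f x := by simp [hg, hyz.ne]
    have gx : g x = f x := by simp [hg, hxz.ne]
    have gp : ∀ a ∈ p, g a = f a := by
      intro a ha
      have := hps a ha
      simp only [hg]
      grind
    have gs : ∀ a ∈ s, g a = f a := by
      intro a ha
      simp only [hg]
      grind
    refine ⟨g, isIncreasingColoring_append_cons_cons_cons.2
      ⟨h1.congr gp, h2.congr gs, fun d hd e he => ?_, fun d hd => ?_, fun e he => ?_,
        ?_, ?_, ?_⟩, ?_⟩
    · rw [gp d hd, gs e he]; exact h3 d hd e he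
    · have := h4 d hd
      rw [gp d hd, gz, gx, gy]
      grind
    · have := h5 e he
      rw [gs e he, gz, gx, gy]
      grind
    · rw [gz, gx]; exact fun h => absurd h hyx
    · rw [gz, gy]; exact fun h => absurd h hyx
    · exact fun _ _ => hxy
    · have e1 : p.countP (fun a => decide (g a < k)) = p.countP (fun a => decide (f a < k)) :=
        List.countP_congr fun a ha => by simp [gp a ha]
      have e2 : s.countP (fun a => decide (g a < k)) = s.countP (fun a => decide (f a < k)) :=
        List.countP_congr fun a ha => by simp [gs a ha]
      simp only [List.countP_append, List.countP_cons, e1, e2, gx, gy, gz, ← hfxz]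
      omega

/-- Mirror image of `coloringLE_left`: when `x` and `z` share a colour, either the tails after `y`
and `x` are exchanged, so that `y` continues with `z`, or an unselected `y` replaces `x` in front of
`z`. -/
theorem coloringLE_right {k : ℕ} (p s : List α) {x y z : α} (hxy : x < y) (hyz : y < z)
    (hnd : (p ++ y :: x :: z :: s).Nodup) :
    ColoringLE k (p ++ y :: x :: z :: s) (p ++ y :: z :: x :: s) := by
  intro f hf
  have hperm : (p ++ y :: x :: z :: s).Perm (p ++ y :: z :: x :: s) :=
    ((List.Perm.swap _ _ _).cons y).append_left p
  simp only [List.nodup_append, List.nodup_cons, List.mem_cons, not_or] at hnd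
  obtain ⟨-, ⟨⟨-, -, hys⟩, ⟨-, hxs⟩, hzs, -⟩, hps⟩ := hnd
  have hf' := isIncreasingColoring_append_cons_cons_cons.1 hf
  obtain ⟨h1, h2, h3, h4, h5, h6, h7, h8⟩ := hf'
  have hxz := hxy.trans hyz
  by_cases hc : f x = f z ∧ f x < k
  swap
  · refine ⟨f, isIncreasingColoring_append_cons_cons_cons.2
      ⟨h1, h2, h3, fun d hd => ?_, fun e he => ?_, ?_, ?_, ?_⟩, (hperm.countP_eq _).le⟩
    all_goals grind
  obtain ⟨hfxz, hfx⟩ := hc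
  have hyx : f y ≠ f x := fun h => absurd (h6 h (h ▸ hfx)) hxy.not_gt
  by_cases hy : f y < k
  · set g : α → ℕ := fun a => if a = z ∨ a ∈ s then Equiv.swap (f x) (f y) (f a) else f a
      with hg
    have gz : g z = f y := by simp [hg, ← hfxz]
    have gy : g y = f y := by simp [hg, hyz.ne, hys]
    have gx : g x = f x := by simp [hg, hxz.ne, hxs]
    have gp : ∀ a ∈ p, g a = f a := by
      intro a ha
      have := hps a ha
      simp only [hg]
      rw [if_neg]
      grind
    have gs : ∀ a ∈ s, g a = Equiv.swap (f x) (f y) (f a) := by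
      intro a ha
      simp [hg, ha]
    refine ⟨g, isIncreasingColoring_append_cons_cons_cons.2
      ⟨h1.congr gp, h2.swap hfx hy gs, fun d hd e he => ?_, fun d hd => ?_, fun e he => ?_,
        ?_, ?_, ?_⟩, ?_⟩
    · have := h4 d hd
      have := h5 e he
      have := h3 d hd e he
      rw [gp d hd, gs e he, Equiv.swap_apply_def]
      clear_value g
      clear hg gs gp hps
      grind
    · have := h4 d hd
      rw [gp d hd, gz, gx, gy]
      grind
    · have := h5 e he
      rw [gs e he, gz, gx, gy, Equiv.swap_apply_def]
      clear_value g
      clear hg gs gp hps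
      grind
    · exact fun _ _ => hyz
    · rw [gy, gx]; exact fun h => absurd h hyx
    · rw [gz, gx]; exact fun h => absurd h hyx
    · rw [hperm.countP_eq]
      refine (List.countP_congr fun a ha => ?_).le
      simp only [hg, decide_eq_true_eq]
      split_ifs
      · rw [swap_lt_iff hfx hy]
      · rfl
  · set g : α → ℕ := fun a => if a = x then f y else if a = y then f x else f a with hg
    have gz : g z = f x := by simp [hg, hyz.ne', hxz.ne', ← hfxz]
    have gy : g y = f x := by simp [hg, hxy.ne']
    have gx : g x = f y := by simp [hg]
    have gp : ∀ a ∈ p, g a = f a := by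
      intro a ha
      have := hps a ha
      simp only [hg]
      grind
    have gs : ∀ a ∈ s, g a = f a := by
      intro a ha
      simp only [hg]
      grind
    refine ⟨g, isIncreasingColoring_append_cons_cons_cons.2
      ⟨h1.congr gp, h2.congr gs, fun d hd e he => ?_, fun d hd => ?_, fun e he => ?_,
        ?_, ?_, ?_⟩, ?_⟩
    · rw [gp d hd, gs e he]; exact h3 d hd e he
    · have := h4 d hd
      rw [gp d hd, gz, gx, gy]
      grind
    · have := h5 e he
      rw [gs e he, gz, gx, gy]
      grind
    · exact fun _ _ => hyz
    · rw [gy, gx]; exact fun h => absurd h hyx.symm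
    · rw [gz, gx]; exact fun h => absurd h hyx.symm
    · have e1 : p.countP (fun a => decide (g a < k)) = p.countP (fun a => decide (f a < k)) :=
        List.countP_congr fun a ha => by simp [gp a ha]
      have e2 : s.countP (fun a => decide (g a < k)) = s.countP (fun a => decide (f a < k)) :=
        List.countP_congr fun a ha => by simp [gs a ha]
      simp only [List.countP_append, List.countP_cons, e1, e2, gx, gy, gz, ← hfxz]
      omega

/-- Each elementary relation needs new colours in one direction only. In the other, `z` precedes
`x`, so they share no selected colour, and exchanging them keeps the same colouring valid. -/
theorem Knuth.coloringLE {u v : List α} (h : Knuth u v) (hu : u.Nodup) (k : ℕ) :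
    ColoringLE k u v ∧ ColoringLE k v u := by
  induction h with
  | refl u => exact ⟨fun f hf => ⟨f, hf, le_rfl⟩, fun f hf => ⟨f, hf, le_rfl⟩⟩
  | symm h ih => exact (ih (h.perm.nodup_iff.2 hu)).symm
  | trans h1 _ ih1 ih2 =>
    have h3 := ih1 hu
    have h4 := ih2 (h1.perm.nodup_iff.1 hu)
    exact ⟨h3.1.trans h4.1, h4.2.trans h3.2⟩
  | left p s hxy hyz =>
    refine ⟨coloringLE_left p s hxy hyz hu,
      coloringLE_of_coloring ((List.Perm.swap _ _ _).append_left p) fun f hf => ?_⟩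
    obtain ⟨h1, h2, h3, h4, h5, h6, h7, h8⟩ := isIncreasingColoring_append_cons_cons_cons.1 hf
    exact isIncreasingColoring_append_cons_cons_cons.2
      ⟨h1, h2, h3, fun d hd => ⟨(h4 d hd).2.1, (h4 d hd).1, (h4 d hd).2.2⟩,
        fun e he => ⟨(h5 e he).2.1, (h5 e he).1, (h5 e he).2.2⟩,
        fun _ _ => hxy.trans hyz, h8, h7⟩
  | right p s hxy hyz =>
    refine ⟨coloringLE_right p s hxy hyz hu,
      coloringLE_of_coloring (((List.Perm.swap _ _ _).cons _).append_left p) fun f hf => ?_⟩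
    obtain ⟨h1, h2, h3, h4, h5, h6, h7, h8⟩ := isIncreasingColoring_append_cons_cons_cons.1 hf
    exact isIncreasingColoring_append_cons_cons_cons.2
      ⟨h1, h2, h3, fun d hd => ⟨(h4 d hd).1, (h4 d hd).2.2, (h4 d hd).2.1⟩,
        fun e he => ⟨(h5 e he).1, (h5 e he).2.2, (h5 e he).2.1⟩,
        h7, h6, fun _ _ => hxy.trans hyz⟩

/-! ### Tableaux and row insertion -/

/-- The row `s` is at most as long as the row `r`, and each of its entries is larger than the
entry of `r` above it. -/
inductive RowAbove : List α → List α → Prop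
  | nil (r : List α) : RowAbove r []
  | cons {a b : α} {r s : List α} : a < b → RowAbove r s → RowAbove (a :: r) (b :: s)

theorem RowAbove.getElem {r s : List α} (h : RowAbove r s) :
    ∃ hl : s.length ≤ r.length, ∀ j (hj : j < s.length), r[j]'(hj.trans_le hl) < s[j] := by
  induction h with
  | nil r => exact ⟨Nat.zero_le _, fun j hj => absurd hj (Nat.not_lt_zero j)⟩
  | cons hab h ih =>
    obtain ⟨hl, ih⟩ := ih
    refine ⟨by simpa using hl, fun j hj => ?_⟩
    cases j with
    | zero => simpa using hab
    | succ j => simpa using ih j (by simpa using hj)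

theorem RowAbove.trans {r s t : List α} (h1 : RowAbove r s) (h2 : RowAbove s t) :
    RowAbove r t := by
  induction h1 generalizing t with
  | nil r => cases h2; exact .nil _
  | cons hab _ ih =>
    cases h2 with
    | nil => exact .nil _
    | cons hbc h2 => exact .cons (hab.trans hbc) (ih h2)

instance : Trans (RowAbove (α := α)) RowAbove RowAbove := ⟨RowAbove.trans⟩

/-- Standard tableaux, as lists of rows. -/
structure IsTableau (T : List (List α)) : Prop where
  rows : ∀ r ∈ T, r.Pairwise (· < ·)
  columns : T.IsChain RowAbove
  ne_nil : [] ∉ T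

/-- The rows of a tableau, concatenated from bottom to top. -/
def readingWord {β : Type*} (T : List (List β)) : List β := T.reverse.flatten

theorem readingWord_cons {β : Type*} (r : List β) (T : List (List β)) :
    readingWord (r :: T) = readingWord T ++ r := by
  simp [readingWord]

theorem rowInsert_spec (x : α) (r : List α) (hr : r.Pairwise (· < ·)) (hx : x ∉ r) :
    (∃ l y s, r = l ++ y :: s ∧ rowInsert x r = (l ++ x :: s, some y) ∧ (∀ a ∈ l, a < x) ∧
      x < y) ∨ (rowInsert x r = (r ++ [x], none) ∧ ∀ a ∈ r, a < x) := by
  induction r with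
  | nil => right; simp [rowInsert]
  | cons a r ih =>
    simp only [List.mem_cons, not_or] at hx
    by_cases hxa : x < a
    · left
      exact ⟨[], a, r, rfl, by simp [rowInsert, hxa], by simp, hxa⟩
    have hax : a < x := lt_of_le_of_ne (not_lt.1 hxa) (Ne.symm hx.1)
    rcases ih hr.of_cons hx.2 with ⟨l, y, s, h1, h2, h3, h4⟩ | ⟨h1, h2⟩
    · left
      refine ⟨a :: l, y, s, by simp [h1], by simp [rowInsert, hxa, h2], ?_, h4⟩
      simpa [hax] using h3
    · right
      exact ⟨by simp [rowInsert, hxa, h1], by simpa [hax] using h2⟩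

theorem tableauInsert_of_none {x : α} {r r' : List α} (T : List (List α))
    (h : rowInsert x r = (r', none)) : tableauInsert x (r :: T) = r' :: T := by
  simp [tableauInsert, h]

theorem tableauInsert_of_some {x y : α} {r r' : List α} (T : List (List α))
    (h : rowInsert x r = (r', some y)) :
    tableauInsert x (r :: T) = r' :: tableauInsert y T := by
  simp [tableauInsert, h]

/-- Treating a missing row as empty gives the new top row a uniform description, so that
`RowAbove.bump` covers the last row as well. -/
theorem exists_tableauInsert_eq_cons (x : α) (T : List (List α)) :
    ∃ S, tableauInsert x T = (rowInsert x (T.headD [])).1 :: S := by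
  cases T with
  | nil => exact ⟨[], by simp [tableauInsert, rowInsert]⟩
  | cons r T =>
    rcases h : rowInsert x r with ⟨r', _ | y⟩
    · exact ⟨T, by simp [tableauInsert_of_none T h, h]⟩
    · exact ⟨tableauInsert y T, by simp [tableauInsert_of_some T h, h]⟩

theorem RowAbove.append_right {r s : List α} (h : RowAbove r s) (t : List α) :
    RowAbove (r ++ t) s := by
  induction h with
  | nil r => exact .nil _
  | cons hab _ ih => exact .cons hab ih

theorem RowAbove.replace {l r s : List α} {x y : α} (hxy : x < y)
    (h : RowAbove (l ++ y :: r) s) : RowAbove (l ++ x :: r) s := by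
  induction l generalizing s with
  | nil =>
    cases h with
    | nil => exact .nil _
    | cons hab h => exact .cons (hxy.trans hab) h
  | cons a l ih =>
    cases h with
    | nil => exact .nil _
    | cons hab h => exact .cons hab (ih h)

/-- The bumped `y` lands weakly to the left of the column it came from: the entry below its old
place, if any, exceeds `y`. Above its new place there is then either an entry of `l` or `x`, all
smaller than `y`. -/
theorem RowAbove.bump {l r s : List α} {x y : α} (hxy : x < y) (hl : ∀ a ∈ l, a < x)
    (h : RowAbove (l ++ y :: r) s) : RowAbove (l ++ x :: r) (rowInsert y s).1 := by
  induction l generalizing s with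
  | nil =>
    cases h with
    | nil => exact .cons hxy (.nil _)
    | cons hyb h =>
      simp only [rowInsert, hyb, if_true]
      exact .cons hxy h
  | cons a l ih =>
    have hay : a < y := (hl a (by simp)).trans hxy
    cases h with
    | nil => exact .cons hay (.nil _)
    | @cons _ b _ s hab h =>
      by_cases hyb : y < b
      · simp only [rowInsert, hyb, if_true]
        exact .cons hay (h.replace hxy)
      · simp only [rowInsert, hyb, if_false]
        exact .cons hab (ih (fun c hc => hl c (by simp [hc])) h)

/-- The two conclusions are proved together because the Knuth equivalence for one row shows that the
bumped letter is absent from the rows below, as needed for the next insertion. -/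
theorem isTableau_tableauInsert (x : α) (T : List (List α)) (hT : IsTableau T)
    (hnd : (readingWord T ++ [x]).Nodup) :
    IsTableau (tableauInsert x T) ∧ Knuth (readingWord T ++ [x]) (readingWord (tableauInsert x T)) := by
  induction T generalizing x with
  | nil =>
    refine ⟨⟨by simp [tableauInsert], by simp [tableauInsert], by simp [tableauInsert]⟩, ?_⟩
    simpa [tableauInsert, readingWord] using Knuth.refl [x]
  | cons r T ih =>
    have hr : r.Pairwise (· < ·) := hT.rows r (by simp)
    have hT' : IsTableau T :=
      ⟨fun s hs => hT.rows s (by simp [hs]), hT.columns.tail, fun h => hT.ne_nil (by simp [h])⟩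
    have hhead : RowAbove r (T.headD []) := by
      cases T with
      | nil => exact .nil _
      | cons s T => exact (List.isChain_cons_cons.1 hT.columns).1
    rw [readingWord_cons, List.append_assoc] at hnd ⊢
    have hx : x ∉ r := by
      have := (List.nodup_append.1 hnd).2.1
      simp only [List.nodup_append] at this
      exact fun h => this.2.2 x h x (by simp) rfl
    rcases rowInsert_spec x r hr hx with ⟨l, y, s, h1, h2, h3, h4⟩ | ⟨h1, h2⟩
    · rw [tableauInsert_of_some T h2, readingWord_cons]
      subst h1
      have hl := (List.pairwise_append.1 hr)
      have hlx : (l ++ [x]).Pairwise (· < ·) := by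
        rw [List.pairwise_append]
        exact ⟨hl.1, by simp, by simpa using h3⟩
      have hK := (knuth_bump x y l s hlx h4 hl.2.1).append_left (readingWord T)
      have hnd' := hK.perm.nodup_iff.1 hnd
      have hsub : (readingWord T ++ [y]).Nodup := by
        refine hnd'.sublist ?_
        exact List.Sublist.append_left (List.singleton_sublist.2 (by simp)) _
      obtain ⟨i1, i2⟩ := ih y hT' hsub
      refine ⟨⟨?_, ?_, ?_⟩, hK.trans ?_⟩
      · intro t ht
        rcases List.mem_cons.1 ht with rfl | ht
        · rw [List.pairwise_append] at hlx ⊢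
          obtain ⟨p1, p2, p3⟩ := hl
          rw [List.pairwise_cons] at p2
          refine ⟨p1, List.pairwise_cons.2 ⟨fun a ha => h4.trans (p2.1 a ha), p2.2⟩, ?_⟩
          intro a ha b hb
          rcases List.mem_cons.1 hb with rfl | hb
          · exact h3 a ha
          · exact p3 a ha b (by simp [hb])
        · exact i1.rows t ht
      · obtain ⟨S, hS⟩ := exists_tableauInsert_eq_cons y T
        have hc := i1.columns
        rw [hS] at hc ⊢
        exact List.isChain_cons_cons.2 ⟨hhead.bump h4 h3, hc⟩
      · simp only [List.mem_cons, not_or]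
        exact ⟨by simp, i1.ne_nil⟩
      · simpa using i2.append_right (l ++ x :: s)
    · rw [tableauInsert_of_none T h1, readingWord_cons]
      refine ⟨⟨?_, ?_, ?_⟩, .refl _⟩
      · intro t ht
        rcases List.mem_cons.1 ht with rfl | ht
        · rw [List.pairwise_append]
          exact ⟨hr, by simp, by simpa using h2⟩
        · exact hT'.rows t ht
      · cases T with
        | nil => simp
        | cons s T => exact List.isChain_cons_cons.2 ⟨hhead.append_right _, hT'.columns⟩
      · simp only [List.mem_cons, not_or]
        exact ⟨by simp, hT'.ne_nil⟩

theorem isTableau_foldl_tableauInsert (u : List α) (hu : u.Nodup) :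
    IsTableau (u.foldl (fun T x => tableauInsert x T) []) ∧
      Knuth u (readingWord (u.foldl (fun T x => tableauInsert x T) [])) := by
  induction u using List.reverseRecOn with
  | nil => exact ⟨⟨by simp, by simp, by simp⟩, .refl _⟩
  | append_singleton u x ih =>
    obtain ⟨h1, h2⟩ := ih (hu.sublist (List.sublist_append_left _ _))
    have h3 := h2.append_right [x]
    obtain ⟨h4, h5⟩ := isTableau_tableauInsert x _ h1 (h3.perm.nodup_iff.1 hu)
    rw [List.foldl_append, List.foldl_cons, List.foldl_nil]
    exact ⟨h4, h3.trans h5⟩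

theorem IsTableau.pairwise {T : List (List α)} (hT : IsTableau T) : T.Pairwise RowAbove :=
  List.isChain_iff_pairwise.1 hT.columns

theorem IsTableau.isPartitionOf {T : List (List α)} (hT : IsTableau T) :
    IsPartitionOf (readingWord T).length (shape T) := by
  refine ⟨?_, ?_, ?_⟩
  · exact List.pairwise_map.2 (hT.pairwise.imp fun h => h.getElem.1)
  · intro p hp
    obtain ⟨r, hr, rfl⟩ := List.mem_map.1 hp
    exact List.length_pos_iff.2 fun h => hT.ne_nil (h ▸ hr)
  · simp [shape, readingWord, List.sum_reverse]

/-! ### The upper bound in Greene's theorem -/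

theorem countP_eq_sum_range {β : Type*} (P : β → Bool) (l : List β) (N : ℕ) (hN : l.length ≤ N) :
    l.countP P = ∑ j ∈ Finset.range N, if l[j]?.any P then 1 else 0 := by
  induction l generalizing N with
  | nil => simp
  | cons a l ih =>
    obtain ⟨N, rfl⟩ : ∃ M, N = M + 1 := ⟨N - 1, by simp at hN; omega⟩
    rw [Finset.sum_range_succ', List.countP_cons, ih N (by simpa using hN)]
    simp

theorem sum_map_eq_sum_range {β : Type*} (T : List (List β)) (F : List β → ℕ) (hF : F [] = 0) (M : ℕ)
    (hM : T.length ≤ M) : (T.map F).sum = ∑ i ∈ Finset.range M, F (T[i]?.getD []) := by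
  induction T generalizing M with
  | nil => simp [hF]
  | cons a l ih =>
    obtain ⟨N, rfl⟩ : ∃ N, M = N + 1 := ⟨M - 1, by simp at hM; omega⟩
    rw [Finset.sum_range_succ', List.map_cons, List.sum_cons, ih N (by simpa using hM)]
    simp [add_comm]

theorem sum_take_shape {β : Type*} (T : List (List β)) (k : ℕ) :
    ((shape T).take k).sum = ∑ i ∈ Finset.range k, (T[i]?.getD []).length := by
  rw [shape, ← List.map_take, sum_map_eq_sum_range _ _ rfl k (by simp)]
  refine Finset.sum_congr rfl fun i hi => ?_
  rw [List.getElem?_take_of_lt (Finset.mem_range.1 hi)]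

/-- Count by columns. The reading word meets a column from bottom to top, hence in decreasing order,
so each selected colour occurs at most once in it. A column thus contributes at most the minimum of
`k` and its height, which is the number of its cells in the first `k` rows. -/
theorem IsTableau.countP_le {T : List (List α)} (hT : IsTableau T) (k : ℕ) (f : α → ℕ)
    (hf : IsIncreasingColoring k f (readingWord T)) :
    (readingWord T).countP (fun a => decide (f a < k)) ≤ ((shape T).take k).sum := by
  classical
  set P : α → Bool := fun a => decide (f a < k) with hP
  obtain ⟨N, hN⟩ : ∃ N, ∀ i : ℕ, (T[i]?.getD []).length ≤ N := by
    refine ⟨(shape T).sum, fun i => ?_⟩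
    rcases h : T[i]? with _ | r
    · simp
    · exact List.single_le_sum (by simp) _ (List.mem_map.2 ⟨r, List.mem_of_getElem? h, rfl⟩)
  have hcount : (readingWord T).countP P = ∑ j ∈ Finset.range N,
      ∑ i ∈ Finset.range (T.length + k), if (T[i]?.getD [])[j]?.any P then 1 else 0 := by
    rw [readingWord, List.countP_flatten, List.map_reverse, List.sum_reverse,
      sum_map_eq_sum_range T _ rfl (T.length + k) (by simp), Finset.sum_comm]
    exact Finset.sum_congr rfl fun i _ => countP_eq_sum_range P _ N (hN i)
  have hsum : ((shape T).take k).sum = ∑ j ∈ Finset.range N,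
      ∑ i ∈ Finset.range k, if j < (T[i]?.getD []).length then 1 else 0 := by
    rw [sum_take_shape, Finset.sum_comm]
    refine Finset.sum_congr rfl fun i _ => ?_
    rw [← Finset.card_filter]
    have : (Finset.range N).filter (fun j => j < (T[i]?.getD []).length) =
        Finset.range (T[i]?.getD []).length := by
      ext j
      have := hN i
      simp only [Finset.mem_filter, Finset.mem_range]
      omega
    rw [this, Finset.card_range]
  have hmono : ∀ i i' : ℕ, i ≤ i' → (T[i']?.getD []).length ≤ (T[i]?.getD []).length := by
    intro i i' hii
    rcases h' : T[i']? with _ | s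
    · simp
    rcases hii.eq_or_lt with rfl | hlt
    · simp [h']
    obtain ⟨hi', rfl⟩ := List.getElem?_eq_some_iff.1 h'
    rw [List.getElem?_eq_getElem (hlt.trans hi')]
    exact (List.pairwise_iff_getElem.1 hT.pairwise i i' (hlt.trans hi') hi' hlt).getElem.1
  rw [hcount, hsum]
  refine Finset.sum_le_sum fun j _ => ?_
  rw [← Finset.card_filter, ← Finset.card_filter]
  have hlt_of : ∀ i : ℕ, (T[i]?.getD [])[j]?.any P = true → ∃ a,
      (T[i]?.getD [])[j]? = some a ∧ f a < k := by
    intro i hi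
    rcases h : (T[i]?.getD [])[j]? with _ | a
    · simp [h] at hi
    · exact ⟨a, rfl, by simpa [h, hP] using hi⟩
  by_cases hall : ∀ i < k, j < (T[i]?.getD []).length
  · have h1 : (Finset.range k).filter (fun i => j < (T[i]?.getD []).length) = Finset.range k :=
      Finset.filter_true_of_mem fun i hi => hall i (Finset.mem_range.1 hi)
    rw [h1]
    -- The colour of the cell in row `i` of column `j`; the default `0` is never used, since only
    -- selected cells are counted.
    set φ : ℕ → ℕ := fun i => ((T[i]?.getD [])[j]?.map f).getD 0 with hφ
    refine Finset.card_le_card_of_injOn φ ?_ ?_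
    · intro i hi
      obtain ⟨a, ha, hak⟩ := hlt_of i (Finset.mem_filter.1 hi).2
      simpa [hφ, ha] using hak
    · have key : ∀ i i' : ℕ, i < i' → (T[i]?.getD [])[j]?.any P = true →
          (T[i']?.getD [])[j]?.any P = true → φ i ≠ φ i' := by
        intro i i' hii hi hi' heq
        obtain ⟨a, ha, hak⟩ := hlt_of i hi
        obtain ⟨b, hb, hbk⟩ := hlt_of i' hi'
        simp only [hφ, ha, hb, Option.map_some, Option.getD_some] at heq
        rcases hr : T[i]? with _ | r
        · simp [hr] at ha
        rcases hs : T[i']? with _ | s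
        · simp [hs] at hb
        rw [hr, Option.getD_some] at ha
        rw [hs, Option.getD_some] at hb
        obtain ⟨hil, rfl⟩ := List.getElem?_eq_some_iff.1 hr
        obtain ⟨hil', rfl⟩ := List.getElem?_eq_some_iff.1 hs
        obtain ⟨hjl, rfl⟩ := List.getElem?_eq_some_iff.1 ha
        obtain ⟨hjl', rfl⟩ := List.getElem?_eq_some_iff.1 hb
        have hab := (List.pairwise_iff_getElem.1 hT.pairwise i i' hil hil' hii).getElem.2 j hjl'
        have hw := (List.pairwise_flatten.1 hf).2
        rw [List.pairwise_reverse] at hw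
        have := List.pairwise_iff_getElem.1 hw i i' hil hil' hii _ (List.getElem_mem hjl') _
          (List.getElem_mem hjl) heq.symm hbk
        exact absurd hab this.not_gt
      intro i hi i' hi' heq
      have hi := (Finset.mem_filter.1 hi).2
      have hi' := (Finset.mem_filter.1 hi').2
      rcases lt_trichotomy i i' with h | h | h
      · exact absurd heq (key i i' h hi hi')
      · exact h
      · exact absurd heq.symm (key i' i h hi' hi)
  -- A column shorter than `k` lies entirely in the first `k` rows.
  · push Not at hall
    obtain ⟨i₀, hi₀, hj⟩ := hall
    refine Finset.card_le_card fun i hi => ?_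
    obtain ⟨a, ha, -⟩ := hlt_of i (Finset.mem_filter.1 hi).2
    obtain ⟨hjl, -⟩ := List.getElem?_eq_some_iff.1 ha
    refine Finset.mem_filter.2 ⟨Finset.mem_range.2 ?_, hjl⟩
    by_contra hik
    have := hmono i₀ i (by omega)
    omega

/-- A union of `k` increasing subsequences of a word is at most as large as the first `k` rows
of its insertion tableau, also if the word is replaced by a Knuth equivalent one. -/
theorem countP_le_of_knuth {u v : List α} (huv : Knuth u v) (hu : u.Nodup) (k : ℕ) (f : α → ℕ)
    (hf : IsIncreasingColoring k f u) : u.countP (fun a => decide (f a < k)) ≤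
      ((shape (v.foldl (fun T x => tableauInsert x T) [])).take k).sum := by
  obtain ⟨h1, h2⟩ := isTableau_foldl_tableauInsert v (huv.perm.nodup_iff.1 hu)
  obtain ⟨g, hg, hfg⟩ := ((huv.trans h2).coloringLE hu k).1 f hf
  exact hfg.trans (h1.countP_le k g hg)

end Words

/-! ### Description of a move -/

theorem foldl_moveBall_of_notMem {n : ℕ} (l : List (Fin n)) (c : Fin n → ℕ) {j : Fin n}
    (hj : j ∉ l) : l.foldl moveBall c j = c j := by
  induction l generalizing c with
  | nil => rfl
  | cons i l ih =>
    simp only [List.mem_cons, not_or] at hj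
    rw [List.foldl_cons, ih _ hj.2, moveBall, Function.update_of_ne hj.1]

theorem foldl_moveBall_of_mem {n : ℕ} (l : List (Fin n)) (c : Fin n → ℕ)
    (hl : l.Pairwise (· < ·)) {k : Fin n} (hk : k ∈ l) :
    l.foldl moveBall c k =
      nextEmpty (fun j => if j ∈ l ∧ j < k then l.foldl moveBall c j else c j) (c k) := by
  induction l generalizing c with
  | nil => simp at hk
  | cons i l ih =>
    have hil : ∀ j ∈ l, i < j := fun j hj => List.rel_of_pairwise_cons hl hj
    have hi : i ∉ l := fun h => (hil i h).false
    rw [List.foldl_cons]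
    rcases List.mem_cons.1 hk with rfl | hkl
    · rw [foldl_moveBall_of_notMem l _ hi, moveBall, Function.update_self]
      congr 1
      funext j
      rw [if_neg]
      rintro ⟨h1, h2⟩
      rcases List.mem_cons.1 h1 with rfl | h1
      · exact h2.false
      · exact (hil j h1).not_gt h2
    · have hik : k ≠ i := (hil k hkl).ne'
      rw [ih _ hl.of_cons hkl]
      congr 1
      · funext j
        by_cases hji : j = i
        · subst hji
          simp [hi, hil k hkl, foldl_moveBall_of_notMem l _ hi]
        · simp [hji, moveBall]
      · rw [moveBall, Function.update_of_ne hik]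

/-- When ball `i` moves, the smaller balls are at their final places and the larger ones have not
moved. The rest of the proof uses this only through `lt_bbsMove`, `bbsMove_ne_of_le` and
`exists_of_lt_bbsMove`. -/
theorem bbsMove_apply {n : ℕ} (c : Fin n → ℕ) (i : Fin n) :
    bbsMove c i = nextEmpty (fun j => if j < i then bbsMove c j else c j) (c i) := by
  have h := foldl_moveBall_of_mem (List.finRange n) c (List.pairwise_lt_finRange n)
    (List.mem_finRange i)
  simpa [bbsMove] using h

theorem lt_bbsMove {n : ℕ} (c : Fin n → ℕ) (i : Fin n) : c i < bbsMove c i := by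
  rw [bbsMove_apply]
  exact (Nat.find_spec (exists_empty_box _ _)).1

theorem bbsMove_ne_of_le {n : ℕ} (c : Fin n → ℕ) {i j : Fin n} (h : i ≤ j) :
    c j ≠ bbsMove c i := by
  rw [bbsMove_apply c i]
  have h1 : (if j < i then bbsMove c j else c j) ≠
      nextEmpty (fun j => if j < i then bbsMove c j else c j) (c i) :=
    (Nat.find_spec (exists_empty_box (fun j => if j < i then bbsMove c j else c j) (c i))).2 j
  rwa [if_neg h.not_gt] at h1

theorem exists_of_lt_bbsMove {n : ℕ} (c : Fin n → ℕ) {i : Fin n} {q : ℕ} (h1 : c i < q)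
    (h2 : q < bbsMove c i) : (∃ j, j < i ∧ bbsMove c j = q) ∨ ∃ j, i < j ∧ c j = q := by
  rw [bbsMove_apply] at h2
  have h3 := Nat.find_min (exists_empty_box (fun j => if j < i then bbsMove c j else c j) (c i)) h2
  push Not at h3
  obtain ⟨j, hj⟩ := h3 h1
  by_cases hji : j < i
  · exact Or.inl ⟨j, hji, by simpa [hji] using hj⟩
  · rw [if_neg hji] at hj
    refine Or.inr ⟨j, lt_of_le_of_ne (not_lt.1 hji) ?_, hj⟩
    rintro rfl
    omega

/-! ### A move preserves the Knuth class of the ball word -/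

theorem eq_of_pairwise_lt_of_mem_iff {α : Type*} [LinearOrder α] {l m : List α}
    (hl : l.Pairwise (· < ·)) (hm : m.Pairwise (· < ·)) (h : ∀ a, a ∈ l ↔ a ∈ m) : l = m :=
  List.Subset.antisymm_of_sortedLT (fun a ha => (h a).1 ha) (fun a ha => (h a).2 ha)
    hl.sortedLT hm.sortedLT

/-- The balls in box `p`. -/
def boxContent {n : ℕ} (c : Fin n → ℕ) (p : ℕ) : List (Fin n) :=
  (List.finRange n).filter fun i => decide (c i = p)

/-- The balls which cross from the boxes before `p` to the boxes from `p` on during a move. -/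
def carrier {n : ℕ} (c : Fin n → ℕ) (p : ℕ) : List (Fin n) :=
  (List.finRange n).filter fun i => decide (c i < p ∧ p ≤ bbsMove c i)

theorem mem_boxContent {n : ℕ} {c : Fin n → ℕ} {p : ℕ} {i : Fin n} :
    i ∈ boxContent c p ↔ c i = p := by
  simp [boxContent]

theorem mem_carrier {n : ℕ} {c : Fin n → ℕ} {p : ℕ} {i : Fin n} :
    i ∈ carrier c p ↔ c i < p ∧ p ≤ bbsMove c i := by
  simp [carrier]

theorem pairwise_lt_carrier {n : ℕ} (c : Fin n → ℕ) (p : ℕ) :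
    (carrier c p).Pairwise (· < ·) :=
  (List.pairwise_lt_finRange n).filter _

theorem pairwise_lt_boxContent {n : ℕ} (c : Fin n → ℕ) (p : ℕ) :
    (boxContent c p).Pairwise (· < ·) :=
  (List.pairwise_lt_finRange n).filter _

theorem boxContent_eq_singleton {n : ℕ} {c : Fin n → ℕ} (hc : Function.Injective c) {p : ℕ}
    {i : Fin n} (hi : c i = p) : boxContent c p = [i] :=
  eq_of_pairwise_lt_of_mem_iff (pairwise_lt_boxContent c p) (by simp) fun a => by
    rw [mem_boxContent, List.mem_singleton, ← hi]
    exact hc.eq_iff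

theorem boxContent_eq_nil {n : ℕ} {c : Fin n → ℕ} {p : ℕ} (h : ∀ i, c i ≠ p) :
    boxContent c p = [] :=
  List.eq_nil_iff_forall_not_mem.2 fun a ha => h a (mem_boxContent.1 ha)

theorem ballWord_perm {n : ℕ} (c : Fin n → ℕ) : (ballWord c).Perm (List.finRange n) :=
  List.mergeSort_perm _ _

theorem ballWord_nodup {n : ℕ} (c : Fin n → ℕ) : (ballWord c).Nodup :=
  (ballWord_perm c).nodup_iff.2 (List.nodup_finRange n)

/-- The ball word is the only listing of the balls along which the boxes increase. -/
theorem ballWord_eq {n : ℕ} {c : Fin n → ℕ} (hc : Function.Injective c) {u : List (Fin n)}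
    (hu : u.Pairwise fun i j => c i < c j) (hmem : ∀ i, i ∈ u) :
    ballWord c = u := by
  have hnd : u.Nodup := hu.imp fun {a b} h hab => (hab ▸ h).false
  have hperm : (ballWord c).Perm u :=
    (ballWord_perm c).trans ((List.perm_ext_iff_of_nodup (List.nodup_finRange n) hnd).2
      fun a => by simp [hmem])
  refine List.Perm.eq_of_pairwise (le := fun i j => c i ≤ c j) ?_ ?_ (hu.imp fun h => h.le) hperm
  · exact fun a b _ _ h1 h2 => hc (le_antisymm h1 h2)
  · have := List.pairwise_mergeSort (le := fun i j => decide (c i ≤ c j))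
      (fun a b d h1 h2 => by simp only [decide_eq_true_eq] at *; omega)
      (fun a b => by simp only [Bool.or_eq_true, decide_eq_true_eq]; omega) (List.finRange n)
    simpa [ballWord] using this

theorem ballWord_eq_flatMap {n : ℕ} {c : Fin n → ℕ} (hc : Function.Injective c) {N : ℕ}
    (hN : ∀ i, c i < N) : ballWord c = (List.range N).flatMap (boxContent c) := by
  refine ballWord_eq hc ?_ fun i => ?_
  · rw [List.flatMap, List.pairwise_flatten, List.pairwise_map]
    refine ⟨?_, ?_⟩
    · intro l hl
      obtain ⟨p, -, rfl⟩ := List.mem_map.1 hl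
      by_cases h : ∃ i, c i = p
      · obtain ⟨i, hi⟩ := h
        simp [boxContent_eq_singleton hc hi]
      · push Not at h
        simp [boxContent_eq_nil h]
    · refine List.pairwise_lt_range.imp fun {p q} hpq a ha b hb => ?_
      rwa [mem_boxContent.1 ha, mem_boxContent.1 hb]
  · exact List.mem_flatMap.2 ⟨c i, List.mem_range.2 (hN i), mem_boxContent.2 rfl⟩

/-- If `y` passed over box `p`, the box would be blocked by a smaller ball that has already landed
there or by a larger one still lying there; the hypotheses exclude both. -/
theorem bbsMove_eq_of_least {n : ℕ} {c : Fin n → ℕ} {p : ℕ} {y : Fin n} (hy : y ∈ carrier c p)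
    (hp : ∀ j, y < j → c j ≠ p)
    (hmin : ∀ z ∈ carrier c p, bbsMove c z = p → y ≤ z) : bbsMove c y = p := by
  obtain ⟨h1, h2⟩ := mem_carrier.1 hy
  by_contra hne
  rcases exists_of_lt_bbsMove c h1 (lt_of_le_of_ne h2 (Ne.symm hne)) with ⟨j, hj, hjp⟩ | ⟨j, hj, hjp⟩
  · exact hj.not_ge (hmin j (mem_carrier.2 ⟨hjp ▸ lt_bbsMove c j, hjp.ge⟩) hjp)
  · exact hp j hj hjp

/-- One step of the carrier. If box `p` holds `x`, only balls larger than `x` can land there, and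
the least such carried ball `y` does: this is row insertion of `x` with `y` bumped. If the box is
empty, the least carried ball lands there and the two words coincide. -/
theorem knuth_carrier_succ {n : ℕ} {c : Fin n → ℕ} (hc : Function.Injective c) (p : ℕ) :
    Knuth (carrier c p ++ boxContent c p) (boxContent (bbsMove c) p ++ carrier c (p + 1)) := by
  have hc' := bbsMove_injective hc
  have hmove : ∀ z, bbsMove c z = p → z ∈ carrier c p := fun z hz =>
    mem_carrier.2 ⟨hz ▸ lt_bbsMove c z, hz.ge⟩
  have hsucc : ∀ a, a ∈ carrier c (p + 1) ↔ (a ∈ carrier c p ∧ bbsMove c a ≠ p) ∨ c a = p := by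
    intro a
    have := lt_bbsMove c a
    simp only [mem_carrier]
    omega
  by_cases hx : ∃ x, c x = p
  · obtain ⟨x, hx⟩ := hx
    have hxC : x ∉ carrier c p := fun h => ((mem_carrier.1 h).1.ne hx)
    have hgt : ∀ z, bbsMove c z = p → x < z := by
      intro z hz
      by_contra h
      exact bbsMove_ne_of_le c (not_lt.1 h) (hx.trans hz.symm)
    have hsucc' : ∀ a, a ∈ carrier c (p + 1) ↔
        (a ∈ carrier c p ∧ bbsMove c a ≠ p) ∨ a = x := by
      intro a
      rw [hsucc, ← hx, hc.eq_iff]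
    rw [boxContent_eq_singleton hc hx]
    set l := (carrier c p).filter (fun a => decide (a < x)) with hl
    set m := (carrier c p).filter (fun a => decide (x < a)) with hm
    have hml : ∀ a, a ∈ l ↔ a ∈ carrier c p ∧ a < x := by simp [hl]
    have hmm : ∀ a, a ∈ m ↔ a ∈ carrier c p ∧ x < a := by simp [hm]
    have hlp : l.Pairwise (· < ·) := (pairwise_lt_carrier c p).filter _
    have hmp : m.Pairwise (· < ·) := (pairwise_lt_carrier c p).filter _
    have hlx : (l ++ [x]).Pairwise (· < ·) := by
      rw [List.pairwise_append]
      exact ⟨hlp, by simp, by simpa using fun a ha => ((hml a).1 ha).2⟩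
    have hsplit : carrier c p = l ++ m := by
      refine eq_of_pairwise_lt_of_mem_iff (pairwise_lt_carrier c p) ?_ fun a => ?_
      · rw [List.pairwise_append]
        exact ⟨hlp, hmp, fun a ha b hb => ((hml a).1 ha).2.trans ((hmm b).1 hb).2⟩
      · rw [List.mem_append, hml, hmm]
        constructor
        · intro ha
          rcases lt_trichotomy a x with h | h | h
          · exact Or.inl ⟨ha, h⟩
          · exact absurd (h ▸ ha) hxC
          · exact Or.inr ⟨ha, h⟩
        · tauto
    rcases hms : m with _ | ⟨y, s⟩
    · have hnone : ∀ z, bbsMove c z ≠ p := fun z hz => by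
        have : z ∈ m := (hmm z).2 ⟨hmove z hz, hgt z hz⟩
        simp [hms] at this
      rw [boxContent_eq_nil hnone, hsplit, hms]
      have : carrier c (p + 1) = l ++ [x] := by
        refine eq_of_pairwise_lt_of_mem_iff (pairwise_lt_carrier c _) hlx fun a => ?_
        rw [hsucc', hsplit, hms]
        simp [hnone]
      rw [this]
      simpa using Knuth.refl (l ++ [x])
    · obtain ⟨hyC, hxy⟩ := (hmm y).1 (by simp [hms])
      rw [hms] at hmp
      have hys : ∀ a ∈ s, y < a := fun a ha => List.rel_of_pairwise_cons hmp ha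
      have hcy : bbsMove c y = p := by
        refine bbsMove_eq_of_least hyC ?_ ?_
        · intro j hj hjp
          rw [← hx] at hjp
          exact (hxy.trans hj).ne' (hc hjp)
        · intro z hz hzp
          have : z ∈ m := (hmm z).2 ⟨hz, hgt z hzp⟩
          rw [hms] at this
          rcases List.mem_cons.1 this with rfl | h
          · exact le_rfl
          · exact (hys z h).le
      rw [boxContent_eq_singleton hc' hcy, hsplit, hms]
      have : carrier c (p + 1) = l ++ x :: s := by
        refine eq_of_pairwise_lt_of_mem_iff (pairwise_lt_carrier c _) ?_ fun a => ?_
        · rw [List.pairwise_append, List.pairwise_cons]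
          refine ⟨hlp, ⟨fun a ha => hxy.trans (hys a ha), hmp.of_cons⟩, fun a ha b hb => ?_⟩
          have hax := ((hml a).1 ha).2
          rcases List.mem_cons.1 hb with rfl | hb
          · exact hax
          · exact hax.trans (hxy.trans (hys b hb))
        · have hiff : bbsMove c a ≠ p ↔ a ≠ y := by rw [← hcy, hc'.ne_iff]
          have hyl : y ∉ l := fun h => hxy.not_gt ((hml y).1 h).2
          have hy_s : y ∉ s := fun h => (hys y h).false
          rw [hsucc', hsplit, hms, hiff]
          simp only [List.mem_append, List.mem_cons]
          constructor
          · tauto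
          · rintro (h | h | h)
            · exact Or.inl ⟨Or.inl h, fun e => hyl (e ▸ h)⟩
            · exact Or.inr h
            · exact Or.inl ⟨Or.inr (Or.inr h), fun e => hy_s (e ▸ h)⟩
      rw [this]
      exact knuth_bump x y l s hlx hxy hmp
  · push Not at hx
    rw [boxContent_eq_nil hx, List.append_nil]
    have hsucc' : ∀ a, a ∈ carrier c (p + 1) ↔ a ∈ carrier c p ∧ bbsMove c a ≠ p := by
      intro a
      simp [hsucc, hx]
    have hCp := pairwise_lt_carrier c p
    rcases hC : carrier c p with _ | ⟨y, s⟩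
    · have hnone : ∀ z, bbsMove c z ≠ p := fun z hz => by
        have := hmove z hz
        simp [hC] at this
      have : carrier c (p + 1) = [] := List.eq_nil_iff_forall_not_mem.2 fun a ha => by
        have := ((hsucc' a).1 ha).1
        simp [hC] at this
      rw [boxContent_eq_nil hnone, this]
      exact .refl _
    · rw [hC] at hCp
      have hys : ∀ a ∈ s, y < a := fun a ha => List.rel_of_pairwise_cons hCp ha
      have hcy : bbsMove c y = p := by
        refine bbsMove_eq_of_least (by simp [hC]) (fun j _ => hx j) fun z hz _ => ?_
        rw [hC] at hz
        rcases List.mem_cons.1 hz with rfl | h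
        · exact le_rfl
        · exact (hys z h).le
      have : carrier c (p + 1) = s := by
        refine eq_of_pairwise_lt_of_mem_iff (pairwise_lt_carrier c _) hCp.of_cons fun a => ?_
        have hiff : bbsMove c a ≠ p ↔ a ≠ y := by rw [← hcy, hc'.ne_iff]
        rw [hsucc', hC, hiff, List.mem_cons]
        constructor
        · tauto
        · exact fun h => ⟨Or.inr h, (hys a h).ne'⟩
      rw [boxContent_eq_singleton hc' hcy, this]
      exact .refl _

/-- The word on the right interpolates: boxes before `p` are already updated, and the balls in
transit follow. Beyond all balls the carrier is empty and the new ball word remains. -/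
theorem knuth_flatMap_boxContent {n : ℕ} {c : Fin n → ℕ} (hc : Function.Injective c) (p : ℕ) :
    Knuth ((List.range p).flatMap (boxContent c))
      ((List.range p).flatMap (boxContent (bbsMove c)) ++ carrier c p) := by
  induction p with
  | zero =>
    have : carrier c 0 = [] := List.eq_nil_iff_forall_not_mem.2 fun a ha =>
      absurd (mem_carrier.1 ha).1 (Nat.not_lt_zero _)
    simpa [this] using Knuth.refl []
  | succ p ih =>
    have h1 := ih.append_right (boxContent c p)
    rw [List.append_assoc] at h1
    have h2 := (knuth_carrier_succ hc p).append_left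
      ((List.range p).flatMap (boxContent (bbsMove c)))
    simpa [List.range_succ, List.flatMap_append] using h1.trans h2

theorem knuth_ballWord_bbsMove {n : ℕ} {c : Fin n → ℕ} (hc : Function.Injective c) :
    Knuth (ballWord c) (ballWord (bbsMove c)) := by
  obtain ⟨N, hN⟩ : ∃ N, ∀ i, bbsMove c i < N := by
    obtain ⟨N, hN⟩ := (Set.finite_range (bbsMove c)).bddAbove
    exact ⟨N + 1, fun i => Nat.lt_succ_of_le (hN ⟨i, rfl⟩)⟩
  have h := knuth_flatMap_boxContent hc N
  have : carrier c N = [] := List.eq_nil_iff_forall_not_mem.2 fun a ha =>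
    (hN a).not_ge (mem_carrier.1 ha).2
  rwa [this, List.append_nil, ← ballWord_eq_flatMap hc fun i => (lt_bbsMove c i).trans (hN i),
    ← ballWord_eq_flatMap (bbsMove_injective hc) hN] at h

theorem ballWord_initialState {n : ℕ} (w : Equiv.Perm (Fin n)) :
    ballWord (initialState w) = List.ofFn w := by
  refine ballWord_eq (bbsState_injective w 0) ?_ fun i => ?_
  · rw [List.pairwise_ofFn]
    intro i j hij
    simpa [bbsState, initialState] using hij
  · exact List.mem_ofFn.2 ⟨w.symm i, by simp⟩

theorem knuth_bbsState {n : ℕ} (w : Equiv.Perm (Fin n)) (t : ℕ) :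
    Knuth (ballWord (bbsState w t)) (List.ofFn w) := by
  induction t with
  | zero => exact ballWord_initialState w ▸ .refl _
  | succ t ih =>
    have h := knuth_ballWord_bbsMove (bbsState_injective w t)
    have e : bbsState w (t + 1) = bbsMove (bbsState w t) :=
      Function.iterate_succ_apply' _ _ _
    rw [e]
    exact h.symm.trans ih

/-! ### Beginnings and ends of increasing runs -/

/-- An increasing run begins in box `p`. -/
def IsRunStart {n : ℕ} (c : Fin n → ℕ) (p : ℕ) : Prop :=
  ∃ y, c y = p ∧ ∀ x, c x + 1 = p → ¬x < y

/-- An increasing run ends in the box before box `p`. -/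
def IsRunEnd {n : ℕ} (c : Fin n → ℕ) (p : ℕ) : Prop :=
  ∃ x, c x + 1 = p ∧ ∀ y, c y = p → ¬x < y

/-- During a move, new runs begin exactly behind the ends of the old runs. -/
theorem isRunStart_bbsMove_iff {n : ℕ} (c : Fin n → ℕ) (p : ℕ) :
    IsRunStart (bbsMove c) p ↔ IsRunEnd c p := by
  constructor
  · rintro ⟨y, hy, hstart⟩
    have hlt := lt_bbsMove c y
    have hbig : ∀ y₂, c y₂ = p → y₂ < y := fun y₂ h => by
      by_contra h'
      exact bbsMove_ne_of_le c (not_lt.1 h') (h.trans hy.symm)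
    -- The old ball in box `p - 1` ends a run: it is either `y` itself or a larger ball that `y` had
    -- to pass, while any old occupant of `p` is smaller than `y`.
    by_cases hq : c y + 1 = p
    · exact ⟨y, hq, fun y₂ h => (hbig y₂ h).not_gt⟩
    · rcases exists_of_lt_bbsMove c (i := y) (q := p - 1) (by omega) (by omega) with
        ⟨j, hj, hjp⟩ | ⟨j, hj, hjp⟩
      · exact absurd hj (hstart j (by omega))
      · exact ⟨j, by omega, fun y₂ h => ((hbig y₂ h).trans hj).not_gt⟩
  · rintro ⟨x, hx, hend⟩
    have hlt := lt_bbsMove c x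
    -- Ball `x` lands in `p` unless `p` is blocked; as `x` ends a run, only a smaller ball that
    -- landed there can block it.
    obtain ⟨y, hyx, hy⟩ : ∃ y, y ≤ x ∧ bbsMove c y = p := by
      by_cases h : bbsMove c x = p
      · exact ⟨x, le_rfl, h⟩
      · rcases exists_of_lt_bbsMove c (i := x) (q := p) (by omega) (by omega) with
          ⟨j, hj, hjp⟩ | ⟨j, hj, hjp⟩
        · exact ⟨j, hj.le, hjp⟩
        · exact absurd hj (hend j hjp)
    refine ⟨y, hy, fun z hz hzy => ?_⟩
    exact bbsMove_ne_of_le c (hzy.le.trans hyx) (i := z) (j := x) (by omega)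

open Classical in
/-- The number of runs which begin in the boxes up to `p`. -/
noncomputable def numStarts {n : ℕ} (c : Fin n → ℕ) (p : ℕ) : ℕ :=
  ((Finset.range (p + 1)).filter (IsRunStart c)).card

open Classical in
/-- The number of runs which end before box `p`. -/
noncomputable def numEnds {n : ℕ} (c : Fin n → ℕ) (p : ℕ) : ℕ :=
  ((Finset.range (p + 1)).filter (IsRunEnd c)).card

/-- The position of the run of ball `x`, counted from the left, beginning with `1`. -/
noncomputable def runIndex {n : ℕ} (c : Fin n → ℕ) (x : Fin n) : ℕ := numStarts c (c x)

open Classical in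
theorem numStarts_succ {n : ℕ} (c : Fin n → ℕ) (p : ℕ) :
    numStarts c (p + 1) = numStarts c p + if IsRunStart c (p + 1) then 1 else 0 := by
  rw [numStarts, Finset.card_filter, Finset.sum_range_succ, ← Finset.card_filter, numStarts]

open Classical in
theorem numEnds_succ {n : ℕ} (c : Fin n → ℕ) (p : ℕ) :
    numEnds c (p + 1) = numEnds c p + if IsRunEnd c (p + 1) then 1 else 0 := by
  rw [numEnds, Finset.card_filter, Finset.sum_range_succ, ← Finset.card_filter, numEnds]

theorem numStarts_mono {n : ℕ} (c : Fin n → ℕ) : Monotone (numStarts c) :=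
  monotone_nat_of_le_succ fun p => by rw [numStarts_succ]; omega

theorem numEnds_mono {n : ℕ} (c : Fin n → ℕ) : Monotone (numEnds c) :=
  monotone_nat_of_le_succ fun p => by rw [numEnds_succ]; omega

theorem numStarts_bbsMove {n : ℕ} (c : Fin n → ℕ) (p : ℕ) :
    numStarts (bbsMove c) p = numEnds c p := by
  classical
  rw [numStarts, numEnds]
  congr 1
  ext q
  simp [isRunStart_bbsMove_iff]

theorem numEnds_lt {n : ℕ} {c : Fin n → ℕ} {a b p : ℕ} (hp : IsRunEnd c p) (hap : a < p)
    (hpb : p ≤ b) : numEnds c a < numEnds c b := by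
  obtain ⟨q, rfl⟩ : ∃ q, p = q + 1 := ⟨p - 1, by omega⟩
  have h1 := numEnds_mono c (Nat.lt_succ_iff.1 hap)
  have h2 := numEnds_mono c hpb
  rw [numEnds_succ, if_pos hp] at h2
  omega

theorem numStarts_lt {n : ℕ} {c : Fin n → ℕ} {a b p : ℕ} (hp : IsRunStart c p) (hap : a < p)
    (hpb : p ≤ b) : numStarts c a < numStarts c b := by
  obtain ⟨q, rfl⟩ : ∃ q, p = q + 1 := ⟨p - 1, by omega⟩
  have h1 := numStarts_mono c (Nat.lt_succ_iff.1 hap)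
  have h2 := numStarts_mono c hpb
  rw [numStarts_succ, if_pos hp] at h2
  omega

open Classical in
-- Every run begun by box `p` has ended before `p`, except the run occupying `p`, if there is one.
theorem numStarts_eq {n : ℕ} {c : Fin n → ℕ} (hc : Function.Injective c) (p : ℕ) :
    numStarts c p = numEnds c p + if ∃ i, c i = p then 1 else 0 := by
  induction p with
  | zero =>
    have h1 : IsRunStart c 0 ↔ ∃ i, c i = 0 := by simp [IsRunStart]
    have h2 : ¬IsRunEnd c 0 := by simp [IsRunEnd]
    simp only [numStarts, numEnds, Finset.card_filter, zero_add, Finset.sum_range_one, h1, h2]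
    simp
  | succ p ih =>
    rw [numStarts_succ, numEnds_succ, ih]
    have key : ((if ∃ i, c i = p then 1 else 0) + if IsRunStart c (p + 1) then 1 else 0 : ℕ) =
        (if IsRunEnd c (p + 1) then 1 else 0) + if ∃ i, c i = p + 1 then 1 else 0 := by
      by_cases h1 : ∃ i, c i = p
      · obtain ⟨x, hx⟩ := h1
        have hx' : ∀ i, c i + 1 = p + 1 ↔ i = x := fun i => by
          rw [Nat.add_right_cancel_iff, ← hx, hc.eq_iff]
        by_cases h2 : ∃ i, c i = p + 1
        · obtain ⟨y, hy⟩ := h2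
          have hy' : ∀ i, c i = p + 1 ↔ i = y := fun i => by rw [← hy, hc.eq_iff]
          have h3 : IsRunStart c (p + 1) ↔ ¬x < y := by
            simp only [IsRunStart, hx', hy', exists_eq_left, forall_eq]
          have h4 : IsRunEnd c (p + 1) ↔ ¬x < y := by
            simp only [IsRunEnd, hx', hy', exists_eq_left, forall_eq]
          rw [if_pos ⟨x, hx⟩, if_pos (⟨y, hy⟩ : ∃ i, c i = p + 1)]
          simp only [h3, h4]
          omega
        · have h3 : ¬IsRunStart c (p + 1) := fun ⟨y, hy, _⟩ => h2 ⟨y, hy⟩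
          have h4 : IsRunEnd c (p + 1) := ⟨x, by omega, fun y hy => absurd ⟨y, hy⟩ h2⟩
          simp [h2, h3, h4, show ∃ i, c i = p from ⟨x, hx⟩]
      · have h3 : ¬IsRunEnd c (p + 1) := fun ⟨x, hx, _⟩ => h1 ⟨x, by omega⟩
        have h4 : IsRunStart c (p + 1) ↔ ∃ i, c i = p + 1 := by
          constructor
          · exact fun ⟨y, hy, _⟩ => ⟨y, hy⟩
          · exact fun ⟨y, hy⟩ => ⟨y, hy, fun x hx => absurd ⟨x, by omega⟩ h1⟩
        simp [h1, h3, h4]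
    omega

/-! ### Growth of the run index in time. -/

theorem runIndex_eq {n : ℕ} {c : Fin n → ℕ} (hc : Function.Injective c) (x : Fin n) :
    runIndex c x = numEnds c (c x) + 1 := by
  classical
  rw [runIndex, numStarts_eq hc, if_pos ⟨x, rfl⟩]

theorem exists_ball_of_not_isRunEnd {n : ℕ} {c : Fin n → ℕ} {x : Fin n} {b : ℕ}
    (h : ∀ p, c x < p → p ≤ b → ¬IsRunEnd c p) (q : ℕ) (h1 : c x ≤ q) (h2 : q ≤ b) :
    ∃ z, c z = q ∧ x ≤ z ∧ (c x < q → x < z) := by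
  induction q, h1 using Nat.le_induction with
  | base => exact ⟨x, rfl, le_rfl, fun h => absurd h (lt_irrefl _)⟩
  | succ q hq ih =>
    obtain ⟨z, hz, hxz, -⟩ := ih (by omega)
    have h3 := h (q + 1) (by omega) h2
    simp only [IsRunEnd, not_exists, not_and, not_forall, not_not] at h3
    obtain ⟨y, hy, hzy⟩ := h3 z (by omega)
    exact ⟨y, hy, (hxz.trans_lt hzy).le, fun _ => hxz.trans_lt hzy⟩

/-- By `numStarts_bbsMove`, it suffices that some old run ends between the old and the new box of
`x`. Otherwise the run of `x` would reach the new box, which would have held a ball at least as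
large as `x` and so been unavailable. -/
theorem runIndex_le_runIndex_bbsMove {n : ℕ} {c : Fin n → ℕ} (hc : Function.Injective c)
    (x : Fin n) : runIndex c x ≤ runIndex (bbsMove c) x := by
  rw [runIndex_eq hc, runIndex, numStarts_bbsMove]
  by_contra hlt
  have hno : ∀ p, c x < p → p ≤ bbsMove c x → ¬IsRunEnd c p := fun p h1 h2 h3 =>
    hlt (numEnds_lt h3 h1 h2)
  obtain ⟨z, hz, hxz, -⟩ := exists_ball_of_not_isRunEnd hno _ (lt_bbsMove c x).le le_rfl
  exact bbsMove_ne_of_le c hxz hz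

theorem runIndex_le {n : ℕ} (c : Fin n → ℕ) (x : Fin n) : runIndex c x ≤ n := by
  classical
  have : (Finset.range (c x + 1)).filter (IsRunStart c) ⊆ Finset.univ.image c := by
    intro p hp
    obtain ⟨y, hy, -⟩ := (Finset.mem_filter.1 hp).2
    exact Finset.mem_image.2 ⟨y, Finset.mem_univ _, hy⟩
  simpa [runIndex, numStarts] using (Finset.card_le_card this).trans Finset.card_image_le

/-! ### The runs of a state are determined by the run indices -/

section RunIndex

variable {n : ℕ} {c : Fin n → ℕ}

theorem runIndex_le_runIndex {x y : Fin n} (h : c x ≤ c y) : runIndex c x ≤ runIndex c y :=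
  numStarts_mono c h

theorem lt_of_runIndex_lt {x y : Fin n} (h : runIndex c x < runIndex c y) : c x < c y := by
  by_contra h'
  exact (runIndex_le_runIndex (not_lt.1 h')).not_gt h

theorem exists_ball_of_runIndex_eq (hc : Function.Injective c) {x y : Fin n}
    (h : runIndex c x = runIndex c y) {q : ℕ} (h1 : c x ≤ q) (h2 : q ≤ c y) :
    ∃ z, c z = q ∧ runIndex c z = runIndex c x ∧ (c x < q → x < z) := by
  rw [runIndex_eq hc, runIndex_eq hc] at h
  obtain ⟨z, hz, -, hxz⟩ := exists_ball_of_not_isRunEnd (c := c) (x := x) (b := c y)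
    (fun p h1 h2 h3 => by have := numEnds_lt h3 h1 h2; omega) q h1 h2
  refine ⟨z, hz, le_antisymm ?_ (runIndex_le_runIndex (hz ▸ h1)), hxz⟩
  refine (runIndex_le_runIndex (y := y) (hz ▸ h2)).trans ?_
  rw [runIndex_eq hc, runIndex_eq hc, h]

theorem lt_of_runIndex_eq (hc : Function.Injective c) {x y : Fin n}
    (h : runIndex c x = runIndex c y) (hxy : c x < c y) : x < y := by
  obtain ⟨z, hz, -, hxz⟩ := exists_ball_of_runIndex_eq hc h hxy.le le_rfl
  exact hc hz ▸ hxz hxy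

theorem apply_lt_of_runIndex_eq (hc : Function.Injective c) {x y : Fin n}
    (h : runIndex c x = runIndex c y) (hxy : x < y) : c x < c y := by
  rcases lt_trichotomy (c x) (c y) with h' | h' | h'
  · exact h'
  · exact absurd (hc h') hxy.ne
  · exact absurd (lt_of_runIndex_eq hc h.symm h') hxy.not_gt

theorem runIndex_eq_of_succ (hc : Function.Injective c) {x y : Fin n} (h : c y = c x + 1)
    (hxy : x < y) : runIndex c y = runIndex c x := by
  classical
  have : ¬IsRunStart c (c x + 1) := by
    rintro ⟨z, hz, h'⟩
    exact h' x rfl (hc (hz.trans h.symm) ▸ hxy)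
  rw [runIndex, h, numStarts_succ, if_neg this, runIndex, add_zero]

end RunIndex

/-- The fibres of `r`, in increasing order of the values. -/
def fiberLists {n : ℕ} (r : Fin n → ℕ) : List (List (Fin n)) :=
  ((Finset.univ.image r).sort (· ≤ ·)).map fun j =>
    (List.finRange n).filter fun i => decide (r i = j)

/-- Within a run, order of labels and order of boxes agree, so the fibres sorted by label
concatenate to the ball word. It follows that constant run indices force constant runs. -/
theorem runs_eq_fiberLists {n : ℕ} {c : Fin n → ℕ} (hc : Function.Injective c) :
    runs c = fiberLists (runIndex c) := by
  have hsort : ((Finset.univ.image (runIndex c)).sort (· ≤ ·)).Pairwise (· < ·) :=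
    (Finset.sortedLT_sort _).pairwise
  have hword : ballWord c = (fiberLists (runIndex c)).flatten := by
    refine ballWord_eq hc ?_ fun i => ?_
    · rw [List.pairwise_flatten, fiberLists, List.pairwise_map]
      refine ⟨?_, hsort.imp fun {j j'} hj a ha b hb => ?_⟩
      · intro l hl
        obtain ⟨j, -, rfl⟩ := List.mem_map.1 hl
        refine List.Pairwise.imp_of_mem ?_ ((List.pairwise_lt_finRange n).filter _)
        intro a b ha hb hab
        have ha := (List.mem_filter.1 ha).2
        have hb := (List.mem_filter.1 hb).2
        simp only [decide_eq_true_eq] at ha hb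
        exact apply_lt_of_runIndex_eq hc (ha.trans hb.symm) hab
      · simp only [List.mem_filter, decide_eq_true_eq] at ha hb
        exact lt_of_runIndex_lt (by omega)
    · simp [fiberLists]
  rw [runs, hword]
  refine List.splitBy_flatten ?_ ?_ ?_
  · intro h
    obtain ⟨j, hj, h⟩ := List.mem_map.1 h
    obtain ⟨i, -, hi⟩ := Finset.mem_image.1 ((Finset.mem_sort _).1 hj)
    have : i ∈ (List.finRange n).filter fun i => decide (runIndex c i = j) := by simp [hi]
    simp [h] at this
  · intro l hl
    obtain ⟨j, -, rfl⟩ := List.mem_map.1 hl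
    rw [List.isChain_iff_forall_rel_of_append_cons_cons]
    intro a b l₁ l₂ hl
    have hp : (l₁ ++ a :: b :: l₂).Pairwise (· < ·) :=
      hl ▸ (List.pairwise_lt_finRange n).filter _
    have hmem : ∀ i, i ∈ l₁ ++ a :: b :: l₂ ↔ runIndex c i = j := fun i => by
      rw [← hl]; simp
    have ha := (hmem a).1 (by simp)
    have hb := (hmem b).1 (by simp)
    rw [List.pairwise_append, List.pairwise_cons, List.pairwise_cons] at hp
    obtain ⟨-, ⟨hab, hbl, -⟩, hlab⟩ := hp
    have hab' := hab b (by simp)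
    have hcab := apply_lt_of_runIndex_eq hc (ha.trans hb.symm) hab'
    -- The ball right behind `a` belongs to the same fibre and lies between `a` and `b` in label;
    -- being neighbours in the list, `a` and `b` leave only `z = b`.
    obtain ⟨z, hz, hrz, haz⟩ := exists_ball_of_runIndex_eq hc (ha.trans hb.symm)
      (Nat.le_succ (c a)) hcab
    have haz := haz (Nat.lt_succ_self _)
    have hzmem := (hmem z).2 (hrz.trans ha)
    have hzb : z ≤ b := by
      by_contra h
      have := apply_lt_of_runIndex_eq hc (hb.trans (hrz.trans ha).symm) (not_le.1 h)
      omega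
    simp only [List.mem_append, List.mem_cons] at hzmem
    rcases hzmem with h | rfl | rfl | h
    · exact absurd (hlab z h a (by simp)) haz.not_gt
    · exact absurd haz (lt_irrefl _)
    · simpa [hab'] using hz
    · exact absurd (hbl z h) hzb.not_gt
  · rw [fiberLists, List.isChain_map]
    refine List.Pairwise.isChain (List.Pairwise.imp_of_mem ?_ hsort)
    intro j j' hj hj' hjj
    have hne : ∀ j ∈ (Finset.univ.image (runIndex c)).sort (· ≤ ·),
        (List.finRange n).filter (fun i => decide (runIndex c i = j)) ≠ [] := by
      intro j hj h
      obtain ⟨i, -, hi⟩ := Finset.mem_image.1 ((Finset.mem_sort _).1 hj)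
      have : i ∈ (List.finRange n).filter fun i => decide (runIndex c i = j) := by simp [hi]
      simp [h] at this
    refine ⟨hne j hj, hne j' hj', decide_eq_false ?_⟩
    rintro ⟨h1, h2⟩
    have h3 := runIndex_eq_of_succ hc h1 h2
    have h4 := (List.mem_filter.1 (List.getLast_mem (hne j hj))).2
    have h5 := (List.mem_filter.1 (List.head_mem (hne j' hj'))).2
    simp only [decide_eq_true_eq] at h4 h5
    omega

/-! ### Steady states -/

/-- As long as the runs do not change, the smallest ball of a run moves by the length of the
run. -/
theorem bbsMove_eq_add_card {n : ℕ} {c : Fin n → ℕ} (hc : Function.Injective c)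
    (hr : runIndex (bbsMove c) = runIndex c) {x : Fin n}
    (hx : ∀ z, runIndex c z = runIndex c x → x ≤ z) :
    bbsMove c x = c x + (Finset.univ.filter fun z => runIndex c z = runIndex c x).card := by
  have hc' := bbsMove_injective hc
  obtain ⟨y, hy, hmax⟩ := Finset.exists_max_image
    (Finset.univ.filter fun z => runIndex c z = runIndex c x) c ⟨x, by simp⟩
  simp only [Finset.mem_filter, Finset.mem_univ, true_and] at hy hmax
  have hcx : ∀ z, runIndex c z = runIndex c x → c x ≤ c z := fun z hz => by
    rcases (hx z hz).eq_or_lt with rfl | h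
    · exact le_rfl
    · exact (apply_lt_of_runIndex_eq hc hz.symm h).le
  -- The run fills the boxes from `c x` to `c y` without a gap.
  have hcard : (Finset.univ.filter fun z => runIndex c z = runIndex c x).card =
      c y + 1 - c x := by
    rw [← Nat.card_Icc, ← Finset.card_image_of_injective _ hc]
    congr 1
    ext q
    simp only [Finset.mem_image, Finset.mem_filter, Finset.mem_univ, true_and, Finset.mem_Icc]
    constructor
    · rintro ⟨z, hz, rfl⟩
      exact ⟨hcx z hz, hmax z hz⟩
    · rintro ⟨h1, h2⟩
      obtain ⟨z, hz, hrz, -⟩ := exists_ball_of_runIndex_eq hc hy.symm h1 h2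
      exact ⟨z, hrz, hz⟩
  have hend : IsRunEnd c (c y + 1) := by
    refine ⟨y, rfl, fun z hz hyz => ?_⟩
    have := hmax z ((runIndex_eq_of_succ hc hz hyz).trans hy)
    omega
  have hstart := (isRunStart_bbsMove_iff c _).2 hend
  have hstart' := hstart
  obtain ⟨z, hz, -⟩ := hstart
  -- The new run beginning at `c y + 1` has the index of the old run; its first ball is therefore
  -- the smallest ball `x` of that fibre.
  have hrz : runIndex (bbsMove c) z = runIndex (bbsMove c) x := by
    rw [hr, ← hy, ← hr, runIndex, hz, numStarts_bbsMove, hr, runIndex_eq hc, numEnds_succ,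
      if_pos hend]
  have hzx : z = x := by
    by_contra hne
    have hlt : x < z := lt_of_le_of_ne (hx z (by rw [← hr]; exact hrz)) (Ne.symm hne)
    have h1 := apply_lt_of_runIndex_eq hc' hrz.symm hlt
    have h2 := numStarts_lt hstart' (hz ▸ h1) le_rfl
    rw [runIndex, runIndex, hz] at hrz
    omega
  have := hcx y hy
  rw [hcard, ← hzx, hz, hzx]
  omega

theorem bbsState_succ {n : ℕ} (w : Equiv.Perm (Fin n)) (t : ℕ) :
    bbsState w (t + 1) = bbsMove (bbsState w t) :=
  Function.iterate_succ_apply' _ _ _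

/-- A monotone sequence in the finite order `Fin n → Fin (n + 1)` is eventually constant. -/
theorem exists_runIndex_bbsState_eq {n : ℕ} (w : Equiv.Perm (Fin n)) :
    ∃ T, ∀ t, T ≤ t → runIndex (bbsState w t) = runIndex (bbsState w T) := by
  let F : ℕ → Fin n → Fin (n + 1) := fun t x =>
    ⟨runIndex (bbsState w t) x, Nat.lt_succ_of_le (runIndex_le _ x)⟩
  have hF : Monotone F := monotone_nat_of_le_succ fun t x => by
    show runIndex (bbsState w t) x ≤ runIndex (bbsState w (t + 1)) x
    rw [bbsState_succ]
    exact runIndex_le_runIndex_bbsMove (bbsState_injective w t) x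
  obtain ⟨T, hT⟩ := WellFoundedGT.monotone_chain_condition ⟨F, hF⟩
  refine ⟨T, fun t ht => funext fun x => ?_⟩
  exact (congrArg Fin.val (congrFun (hT t ht) x)).symm

theorem bbsState_eq_add_mul {n : ℕ} (w : Equiv.Perm (Fin n)) {T : ℕ}
    (hT : ∀ t, T ≤ t → runIndex (bbsState w t) = runIndex (bbsState w T)) {x : Fin n}
    (hx : ∀ z, runIndex (bbsState w T) z = runIndex (bbsState w T) x → x ≤ z) (t : ℕ) :
    bbsState w (T + t) x = bbsState w T x + t *
      (Finset.univ.filter fun z =>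
        runIndex (bbsState w T) z = runIndex (bbsState w T) x).card := by
  induction t with
  | zero => simp
  | succ t ih =>
    have h1 := hT (T + t) (by omega)
    have h2 := hT (T + t + 1) (by omega)
    rw [bbsState_succ] at h2
    have h3 := bbsMove_eq_add_card (bbsState_injective w (T + t)) (h2.trans h1.symm) (x := x)
      (by rw [h1]; exact hx)
    rw [← add_assoc, bbsState_succ, h3, ih, h1]
    ring

theorem card_fiber_le_card_fiber {n : ℕ} (w : Equiv.Perm (Fin n)) {T : ℕ}
    (hT : ∀ t, T ≤ t → runIndex (bbsState w t) = runIndex (bbsState w T)) {x y : Fin n}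
    (hxy : runIndex (bbsState w T) x < runIndex (bbsState w T) y) :
    (Finset.univ.filter fun z => runIndex (bbsState w T) z = runIndex (bbsState w T) x).card ≤
      (Finset.univ.filter fun z =>
        runIndex (bbsState w T) z = runIndex (bbsState w T) y).card := by
  set r := runIndex (bbsState w T) with hr
  have hmin : ∀ x, ∃ x', r x' = r x ∧ ∀ z, r z = r x' → x' ≤ z := fun x => by
    obtain ⟨x', h1, h2⟩ := Finset.exists_min_image (Finset.univ.filter fun z => r z = r x) id
      ⟨x, by simp⟩
    simp only [Finset.mem_filter, Finset.mem_univ, true_and, id] at h1 h2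
    exact ⟨x', h1, fun z hz => h2 z (hz.trans h1)⟩
  obtain ⟨x', hx', hx'min⟩ := hmin x
  obtain ⟨y', hy', hy'min⟩ := hmin y
  rw [← hx', ← hy'] at hxy ⊢
  by_contra! hlt
  -- A longer left run gains at least one box per move, so after as many moves as the box number of
  -- `y'` its first ball has caught up with `y'`, although the run indices still put it strictly to
  -- the left.
  have h1 := bbsState_eq_add_mul w hT hx'min (bbsState w T y')
  have h2 := bbsState_eq_add_mul w hT hy'min (bbsState w T y')
  have h3 : bbsState w (T + bbsState w T y') x' < bbsState w (T + bbsState w T y') y' :=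
    lt_of_runIndex_lt (by rw [hT _ (Nat.le_add_right _ _)]; exact hxy)
  rw [h1, h2, ← hr] at h3
  have h4 := Nat.mul_le_mul_left (bbsState w T y') hlt
  rw [Nat.mul_succ] at h4
  omega

theorem pairwise_shape_fiberLists {n : ℕ} (w : Equiv.Perm (Fin n)) {T : ℕ}
    (hT : ∀ t, T ≤ t → runIndex (bbsState w t) = runIndex (bbsState w T)) :
    (shape (fiberLists (runIndex (bbsState w T)))).Pairwise (· ≤ ·) := by
  have hlen : ∀ j, ((List.finRange n).filter
      fun i => decide (runIndex (bbsState w T) i = j)).length =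
      (Finset.univ.filter fun z => runIndex (bbsState w T) z = j).card := fun j => by
    rw [← List.toFinset_card_of_nodup ((List.nodup_finRange n).filter _)]
    congr 1
    ext i
    simp
  rw [shape, fiberLists, List.pairwise_map, List.pairwise_map]
  refine List.Pairwise.imp_of_mem ?_ (Finset.sortedLT_sort _).pairwise
  intro j j' hj hj' hjj
  obtain ⟨x, -, rfl⟩ := Finset.mem_image.1 ((Finset.mem_sort _).1 hj)
  obtain ⟨y, -, rfl⟩ := Finset.mem_image.1 ((Finset.mem_sort _).1 hj')
  rw [hlen, hlen]
  exact card_fiber_le_card_fiber w hT hjj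

/-! ### Comparison of the two partitions -/

/-- Colour the lists from the right with `0`, `1`, `2`, …; the colours below `k` select the last `k`
lists, which are the first `k` rows after reversal. -/
theorem exists_isIncreasingColoring_flatten {α : Type*} [LinearOrder α] (L : List (List α))
    (hL : ∀ l ∈ L, l.Pairwise (· < ·)) (hnd : L.flatten.Nodup) (k : ℕ) :
    ∃ f, IsIncreasingColoring k f L.flatten ∧
      ((shape L.reverse).take k).sum ≤ L.flatten.countP fun a => decide (f a < k) := by
  induction L using List.reverseRecOn generalizing k with
  | nil => exact ⟨fun _ => 0, by simp [IsIncreasingColoring], by simp [shape]⟩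
  | append_singleton L l ih =>
    cases k with
    | zero =>
      exact ⟨fun _ => 0, List.pairwise_of_forall fun _ _ _ h => absurd h (lt_irrefl _), by simp⟩
    | succ k =>
      rw [List.flatten_append, List.flatten_singleton] at hnd ⊢
      rw [List.nodup_append] at hnd
      obtain ⟨f, hf, hk⟩ := ih (fun m hm => hL m (by simp [hm])) hnd.1 k
      set g : α → ℕ := fun a => if a ∈ l then 0 else f a + 1 with hg
      have gl : ∀ a ∈ l, g a = 0 := fun a ha => by simp [hg, ha]
      have gL : ∀ a ∈ L.flatten, g a = f a + 1 := fun a ha => by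
        have : a ∉ l := fun h => hnd.2.2 a ha a h rfl
        simp [hg, this]
      refine ⟨g, ?_, ?_⟩
      · rw [IsIncreasingColoring, List.pairwise_append]
        refine ⟨List.Pairwise.imp_of_mem ?_ hf, ?_, ?_⟩
        · intro a b ha hb hab
          rw [gL a ha, gL b hb]
          exact fun h1 h2 => hab (by omega) (by omega)
        · exact (hL l (by simp)).imp fun h _ _ => h
        · intro a ha b hb h
          rw [gL a ha, gl b hb] at h
          omega
      · have h1 : L.flatten.countP (fun a => decide (g a < k + 1)) =
            L.flatten.countP (fun a => decide (f a < k)) :=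
          List.countP_congr fun a ha => by simp [gL a ha]
        have h2 : l.countP (fun a => decide (g a < k + 1)) = l.length :=
          List.countP_eq_length.2 fun a ha => by simp [gl a ha]
        rw [List.countP_append, h1, h2]
        have h3 : shape (L ++ [l]).reverse = l.length :: shape L.reverse := by simp [shape]
        rw [h3, List.take_succ_cons, List.sum_cons]
        omega

theorem flatten_runs {n : ℕ} (c : Fin n → ℕ) : (runs c).flatten = ballWord c :=
  List.flatten_splitBy _ _

theorem pairwise_lt_of_mem_runs {n : ℕ} (c : Fin n → ℕ) {l : List (Fin n)} (hl : l ∈ runs c) :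
    l.Pairwise (· < ·) :=
  List.isChain_iff_pairwise.1 ((List.isChain_of_mem_splitBy hl).imp fun a b h => by
    simp only [decide_eq_true_eq] at h
    exact h.2)

theorem isPartitionOf_insertionTableau {n : ℕ} (w : Equiv.Perm (Fin n)) :
    IsPartitionOf n (shape (insertionTableau w)) := by
  obtain ⟨h1, h2⟩ := isTableau_foldl_tableauInsert (List.ofFn w)
    (List.nodup_ofFn.2 w.injective)
  have h3 := h1.isPartitionOf
  rwa [← h2.perm.length_eq, List.length_ofFn] at h3

end BoxBall

/-! ### Conclusion: steadiness, the two partitions and dominance. -/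

theorem corollary2p4 (n : ℕ) (w : Equiv.Perm (Fin n)) :
    (∃ t : ℕ, BoxBall.IsSteadyState (BoxBall.bbsState w t)) ∧
    BoxBall.IsPartitionOf n (BoxBall.shape (BoxBall.solitonDecomposition w)) ∧
    BoxBall.IsPartitionOf n (BoxBall.shape (BoxBall.insertionTableau w)) ∧
    BoxBall.DominanceLE (BoxBall.shape (BoxBall.solitonDecomposition w))
      (BoxBall.shape (BoxBall.insertionTableau w)) := by
  obtain ⟨T, hT⟩ := BoxBall.exists_runIndex_bbsState_eq w
  have hruns := fun t => BoxBall.runs_eq_fiberLists (BoxBall.bbsState_injective w t)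
  have hsteady : BoxBall.IsSteadyState (BoxBall.bbsState w T) := by
    intro t
    rw [BoxBall.bbsState, ← Function.iterate_add_apply, ← BoxBall.bbsState, ← BoxBall.bbsState,
      hruns, hruns, hT _ (Nat.le_add_left _ _)]
  have hword := BoxBall.flatten_runs (BoxBall.bbsState w T)
  have hnd := BoxBall.ballWord_nodup (BoxBall.bbsState w T)
  rw [BoxBall.solitonDecomposition_eq w T hsteady]
  refine ⟨⟨T, hsteady⟩, ⟨?_, ?_, ?_⟩, BoxBall.isPartitionOf_insertionTableau w, fun k => ?_⟩
  · rw [BoxBall.shape, List.map_reverse, List.pairwise_reverse, hruns]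
    exact BoxBall.pairwise_shape_fiberLists w hT
  · intro p hp
    obtain ⟨l, hl, rfl⟩ := List.mem_map.1 hp
    refine List.length_pos_iff.2 fun h => ?_
    subst h
    exact List.nil_notMem_splitBy _ _ (List.mem_reverse.1 hl)
  · rw [BoxBall.shape, List.map_reverse, List.sum_reverse, ← List.length_flatten, hword,
      (BoxBall.ballWord_perm _).length_eq, List.length_finRange]
  -- The `k` rightmost solitons are increasing subsequences of the steady ball word, which is Knuth
  -- equivalent to `w`.
  · obtain ⟨f, hf, hk⟩ := BoxBall.exists_isIncreasingColoring_flatten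
      (BoxBall.runs (BoxBall.bbsState w T)) (fun l hl => BoxBall.pairwise_lt_of_mem_runs _ hl)
      (hword ▸ hnd) k
    rw [hword] at hf hk
    exact hk.trans (BoxBall.countP_le_of_knuth (BoxBall.knuth_bbsState w T) hnd k f hf)
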